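/- Let $M$ be a smooth (Hausdorff, finite-dimensional, real) manifold with an almost complex structure $J$, i.e. a smooth $(1,1)$-tensor field with $J^2=-\mathrm{Id}$, and let $N_J(X,Y)=[JX,JY]-J[X,JY]-J[JX,Y]-[X,Y]$ be its Nijenhuis tensor. Let $\nabla$ be a smooth connection on $TM$ with torsion $T(X,Y)=\nabla_XY-\nabla_YX-[X,Y]$, and put $$(\nabla J)(X,Y)=\nabla_X(JY)-J\nabla_XY,\qquad [\nabla J](X,Y)=-(\nabla J)(X,Y)+(\nabla J)(Y,X),$$ $$S(X,Y)=-(\nabla J)(X,Y)+(\nabla J)(Y,X)+T(JX,Y)-J\,T(X,Y).$$ Let $\pi:T^*M\to M$ be the projection, let $\theta_\xi=\xi\circ d_\xi\pi$ be the Liouville form on $T^*M$, $\omega_{st}=d\theta$ the canonical symplectic form, and $\theta(J)_\xi=\xi\circ J\circ d_\xi\pi$, where $d\alpha(X,Y)=X\alpha(Y)-Y\alpha(X)-\alpha([X,Y])$. For a tensor field $R$ of type $(1,2)$ on $M$ let $\gamma(R)$ be the endomorphism field of $T(T^*M)$ given in local coordinates $(x,p)$ by $\gamma(R)=p_kR^k_{i,j}\,dx^i\otimes\partial_{p_j}$.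 Consider the following endomorphism fields of $T(T^*M)$. (a) The complete lift $J^c$ of $J$, defined by $d(\theta(J))=\omega_{st}(J^c\cdot,\cdot)$, and Satô's lift $\tilde J=J^c-\frac12\gamma(JN_J)$. (b) The Ishihara–Yano horizontal lift $J^{H,\nabla}=J^c+\gamma([\tilde\nabla J])$, where $\tilde\nabla=\nabla-\frac12T$. (c) The generalized horizontal lift $J^{G,\nabla}$. For $\xi\in T^*M$ with $x=\pi(\xi)$ let $H^\nabla_\xi$ be the set of all $d_xs(X)$ with $X\in T_xM$ and $s$ a smooth section of $T^*M$ such that $s(x)=\xi$ and $\nabla_Xs=0$ at $x$, for the connection on $T^*M$ induced by $\nabla$, $(\nabla_Xs)(Y)=X.s(Y)-s(\nabla_XY)$. Then $T_\xi T^*M=H^\nabla_\xi\oplus T^*_xM$, where $T_x^*M$ is embedded as the vertical space and $d_\xi\pi$ identifies $H^\nabla_\xi$ with $T_xM$, and in this decomposition $J^{G,\nabla}_\xi=J_x\oplus{}^tJ_x$. The connection $\nabla$ is called almost complex if $\nabla_X(JY)=J\nabla_XY$ for all smooth vector fields $X,Y$, and minimal if $T=\frac14N_J$. Then: (1) For every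 connection $\nabla$, $J^{G,\nabla}=\tilde J$ if and only if $S=-\frac12JN_J$. (2) For every connection $\nabla$, $J^{G,\nabla}=J^{H,\nabla}$ if and only if $T(JX,Y)=T(X,JY)$ for all $X,Y$. (3) For every almost complex minimal connection $\nabla$, $J^{G,\nabla}=\tilde J=J^{H,\nabla}$. -/

import Mathlib

open Bundle Manifold
open scoped ContDiff Topology

/-! ## The cotangent bundle of a smooth manifold modelled on a normed space `E` -/

/-- The cotangent space at a point. -/
abbrev CotangentSpace (E : Type*) [NormedAddCommGroup E] [NormedSpace ℝ E]
    {M : Type*} [TopologicalSpace M] [ChartedSpace E M] (x : M) : Type _ :=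
  TangentSpace 𝓘(ℝ, E) x →L[ℝ] ℝ

/-- The total space of the cotangent bundle; a point `ξ` has a base point `ξ.proj` and a covector
`ξ.2` at `ξ.proj`. -/
abbrev CotangentBundle (E : Type*) [NormedAddCommGroup E] [NormedSpace ℝ E]
    (M : Type*) [TopologicalSpace M] [ChartedSpace E M] : Type _ :=
  TotalSpace (E →L[ℝ] ℝ) (CotangentSpace E (M := M))

/-- The model of the manifold `T^*M`. -/
noncomputable abbrev cotangentModel (E : Type*) [NormedAddCommGroup E] [NormedSpace ℝ E] :=
  𝓘(ℝ, E).prod 𝓘(ℝ, E →L[ℝ] ℝ)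

/-- The tangent space of the manifold `T^*M` at `ξ`. -/
abbrev CotangentBundle.Tangent {E : Type*} [NormedAddCommGroup E] [NormedSpace ℝ E]
    {M : Type*} [TopologicalSpace M] [ChartedSpace E M] [IsManifold 𝓘(ℝ, E) ∞ M]
    (ξ : CotangentBundle E M) : Type _ :=
  TangentSpace (cotangentModel E) ξ

/-- Connections on `M`, that is, covariant derivatives on `TM`; `∇_X Y` at `x` is
written `cov Y x (X x)`. -/
abbrev Connection (E : Type*) [NormedAddCommGroup E] [NormedSpace ℝ E]
    (M : Type*) [TopologicalSpace M] [ChartedSpace E M] [IsManifold 𝓘(ℝ, E) ∞ M] : Type _ :=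
  CovariantDerivative 𝓘(ℝ, E) E (TangentSpace 𝓘(ℝ, E) : M → Type _)

/-- Tensor fields on `M`, twice covariant and once contravariant. -/
abbrev BilinearTensor (E : Type*) [NormedAddCommGroup E] [NormedSpace ℝ E]
    (M : Type*) [TopologicalSpace M] [ChartedSpace E M] : Type _ :=
  ∀ x : M, TangentSpace 𝓘(ℝ, E) x →L[ℝ] TangentSpace 𝓘(ℝ, E) x →L[ℝ] TangentSpace 𝓘(ℝ, E) x

/-- Fields of endomorphisms of the tangent spaces of `T^*M`. -/
abbrev CotangentEndomorphism (E : Type*) [NormedAddCommGroup E] [NormedSpace ℝ E]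
    (M : Type*) [TopologicalSpace M] [ChartedSpace E M] [IsManifold 𝓘(ℝ, E) ∞ M] : Type _ :=
  ∀ ξ : CotangentBundle E M, ξ.Tangent →ₗ[ℝ] ξ.Tangent

instance TangentSpace.instFiniteDimensionalSelf {E : Type*} [NormedAddCommGroup E]
    [NormedSpace ℝ E] [FiniteDimensional ℝ E] {M : Type*} [TopologicalSpace M] [ChartedSpace E M]
    (x : M) : FiniteDimensional ℝ (TangentSpace 𝓘(ℝ, E) x) :=
  inferInstanceAs (FiniteDimensional ℝ E)

instance TangentSpace.instT2SpaceSelf {E : Type*} [NormedAddCommGroup E]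
    [NormedSpace ℝ E] {M : Type*} [TopologicalSpace M] [ChartedSpace E M]
    (x : M) : T2Space (TangentSpace 𝓘(ℝ, E) x) :=
  inferInstanceAs (T2Space E)

instance CotangentBundle.instFiniteDimensionalTangent {E : Type*} [NormedAddCommGroup E]
    [NormedSpace ℝ E] [FiniteDimensional ℝ E] {M : Type*} [TopologicalSpace M] [ChartedSpace E M]
    [IsManifold 𝓘(ℝ, E) ∞ M] (ξ : CotangentBundle E M) : FiniteDimensional ℝ ξ.Tangent :=
  inferInstanceAs (FiniteDimensional ℝ (E × (E →L[ℝ] ℝ)))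

section Basic

variable {E : Type*} [NormedAddCommGroup E] [NormedSpace ℝ E]
  {M : Type*} [TopologicalSpace M] [ChartedSpace E M]

/-- `X ∈ Γ(TM)`: a smooth vector field. -/
def IsSmoothVectorField [IsManifold 𝓘(ℝ, E) ∞ M] (X : ∀ x : M, TangentSpace 𝓘(ℝ, E) x) : Prop :=
  ContMDiff 𝓘(ℝ, E) (𝓘(ℝ, E).prod 𝓘(ℝ, E)) ∞ (fun x ↦ TotalSpace.mk' E x (X x))

/-- `s ∈ Γ(T^*M)`: a smooth one-form on `M`. -/
def IsSmoothCovectorField [IsManifold 𝓘(ℝ, E) ∞ M] (s : ∀ x : M, CotangentSpace E x) : Prop :=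
  ContMDiff 𝓘(ℝ, E) (cotangentModel E) ∞ (fun x ↦ TotalSpace.mk' (E →L[ℝ] ℝ) x (s x))

/-- The exterior derivative of a one-form on a manifold (without boundary, in the uses below),
computed at `q` in the preferred chart at `q`:
`dα(u, v) = (D_u α)(v) - (D_v α)(u)`, which is the convention
`dα(X, Y) = X(α(Y)) - Y(α(X)) - α([X, Y])`. -/
noncomputable def exteriorDerivative {F : Type*} [NormedAddCommGroup F] [NormedSpace ℝ F]
    {H : Type*} [TopologicalSpace H] (I : ModelWithCorners ℝ F H)
    {N : Type*} [TopologicalSpace N] [ChartedSpace H N]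
    (α : ∀ q : N, TangentSpace I q →L[ℝ] ℝ) (q : N) :
    TangentSpace I q →ₗ[ℝ] TangentSpace I q →ₗ[ℝ] ℝ :=
  let φ := extChartAt I q
  let D : F →L[ℝ] F →L[ℝ] ℝ := fderivWithin ℝ
    (fun y ↦ (α (φ.symm y)).comp (mfderivWithin 𝓘(ℝ, F) I φ.symm (Set.range I) y))
    (Set.range I) (φ q)
  let L : TangentSpace I q →L[ℝ] F := mfderiv I 𝓘(ℝ, F) φ q
  LinearMap.mk₂ ℝ (fun u v ↦ D (L u) (L v) - D (L v) (L u))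
    (fun u u' v ↦ by simp only [map_add, add_apply]; ring)
    (fun c u v ↦ by simp only [map_smul, smul_apply, smul_eq_mul]; ring)
    (fun u v v' ↦ by simp only [map_add, add_apply]; ring)
    (fun c u v ↦ by simp only [map_smul, smul_apply, smul_eq_mul]; ring)

end Basic

/-! ## Almost complex structures -/

/-- An almost complex structure on `M`: a smooth tensor field `J` of type `(1,1)` with
`J ∘ J = -Id`. -/
structure AlmostComplexStructure (E : Type*) [NormedAddCommGroup E] [NormedSpace ℝ E]
    (M : Type*) [TopologicalSpace M] [ChartedSpace E M] [IsManifold 𝓘(ℝ, E) ∞ M] where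
  toFun : ∀ x : M, TangentSpace 𝓘(ℝ, E) x →L[ℝ] TangentSpace 𝓘(ℝ, E) x
  contMDiff' : ContMDiff 𝓘(ℝ, E) (𝓘(ℝ, E).prod 𝓘(ℝ, E →L[ℝ] E)) ∞
    (fun x ↦ TotalSpace.mk' (E →L[ℝ] E) x (toFun x))
  sq' : ∀ (x : M) (v : TangentSpace 𝓘(ℝ, E) x), toFun x (toFun x v) = -v

namespace AlmostComplexStructure

variable {E : Type*} [NormedAddCommGroup E] [NormedSpace ℝ E]
  {M : Type*} [TopologicalSpace M] [ChartedSpace E M] [IsManifold 𝓘(ℝ, E) ∞ M]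

instance : CoeFun (AlmostComplexStructure E M)
    fun _ ↦ ∀ x : M, TangentSpace 𝓘(ℝ, E) x →L[ℝ] TangentSpace 𝓘(ℝ, E) x := ⟨toFun⟩

variable (J : AlmostComplexStructure E M)

/-- The vector field `JX`. -/
noncomputable def onField (X : ∀ x : M, TangentSpace 𝓘(ℝ, E) x) : ∀ x : M, TangentSpace 𝓘(ℝ, E) x :=
  fun x ↦ J x (X x)

open VectorField in
/-- `[JX, JY] - J[X, JY] - J[JX, Y] - [X, Y]` for vector fields `X`, `Y`. -/
noncomputable def nijenhuisField (X Y : ∀ x : M, TangentSpace 𝓘(ℝ, E) x) (x : M) :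
    TangentSpace 𝓘(ℝ, E) x :=
  mlieBracket 𝓘(ℝ, E) (J.onField X) (J.onField Y) x
    - J x (mlieBracket 𝓘(ℝ, E) X (J.onField Y) x)
    - J x (mlieBracket 𝓘(ℝ, E) (J.onField X) Y x)
    - mlieBracket 𝓘(ℝ, E) X Y x

theorem mdifferentiableAt_onField {X : ∀ x : M, TangentSpace 𝓘(ℝ, E) x} {x : M}
    (hX : MDiffAt (T% X) x) : MDiffAt (T% (J.onField X)) x :=
  MDifferentiableAt.clm_bundle_apply (J.contMDiff'.contMDiffAt.mdifferentiableAt (by simp)) hX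

theorem onField_add (X Y : ∀ x : M, TangentSpace 𝓘(ℝ, E) x) :
    J.onField (X + Y) = J.onField X + J.onField Y := by
  funext x; simp [onField]

theorem onField_smul (f : M → ℝ) (X : ∀ x : M, TangentSpace 𝓘(ℝ, E) x) :
    J.onField (f • X) = f • J.onField X := by
  funext x; simp [onField]

theorem nijenhuisField_swap (X Y : ∀ x : M, TangentSpace 𝓘(ℝ, E) x) (x : M) :
    J.nijenhuisField X Y x = - J.nijenhuisField Y X x := by
  simp only [nijenhuisField]
  rw [VectorField.mlieBracket_swap_apply (V := J.onField X) (W := J.onField Y),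
    VectorField.mlieBracket_swap_apply (V := X) (W := J.onField Y),
    VectorField.mlieBracket_swap_apply (V := J.onField X) (W := Y),
    VectorField.mlieBracket_swap_apply (V := X) (W := Y)]
  simp only [map_neg]
  abel

variable [FiniteDimensional ℝ E]

theorem nijenhuisField_tensorial (x : M) (Y : ∀ x : M, TangentSpace 𝓘(ℝ, E) x) :
    TensorialAt 𝓘(ℝ, E) E (fun X ↦ J.nijenhuisField X Y x) x where
  smul {f X} hf hX := by
    have : CompleteSpace E := FiniteDimensional.complete ℝ E
    have h := J.mdifferentiableAt_onField hX
    simp only [nijenhuisField, onField_smul]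
    rw [VectorField.mlieBracket_smul_left hf hX, VectorField.mlieBracket_smul_left hf h,
      VectorField.mlieBracket_smul_left hf hX, VectorField.mlieBracket_smul_left hf h]
    simp only [map_add, map_smul, onField, J.sq']
    module
  add {X X'} hX hX' := by
    have : CompleteSpace E := FiniteDimensional.complete ℝ E
    have h := J.mdifferentiableAt_onField hX
    have h' := J.mdifferentiableAt_onField hX'
    simp only [nijenhuisField, onField_add]
    rw [VectorField.mlieBracket_add_left hX hX', VectorField.mlieBracket_add_left h h',
      VectorField.mlieBracket_add_left hX hX', VectorField.mlieBracket_add_left h h']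
    simp only [map_add]
    abel

theorem nijenhuisField_tensorial' (x : M) (X : ∀ x : M, TangentSpace 𝓘(ℝ, E) x) :
    TensorialAt 𝓘(ℝ, E) E (fun Y ↦ J.nijenhuisField X Y x) x where
  smul {f Y} hf hY := by
    rw [J.nijenhuisField_swap X (f • Y), J.nijenhuisField_swap X Y,
      (J.nijenhuisField_tensorial x X).smul hf hY, smul_neg]
  add {Y Y'} hY hY' := by
    rw [J.nijenhuisField_swap X (Y + Y'), J.nijenhuisField_swap X Y, J.nijenhuisField_swap X Y',
      (J.nijenhuisField_tensorial x X).add hY hY', neg_add]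

/-- The Nijenhuis tensor `N_J` (with values `N_J(X, Y)` at `x` given by `nijenhuisField`
for all vector fields `X`, `Y` that are differentiable at `x`). -/
noncomputable def nijenhuis (x : M) :
    TangentSpace 𝓘(ℝ, E) x →L[ℝ] TangentSpace 𝓘(ℝ, E) x →L[ℝ] TangentSpace 𝓘(ℝ, E) x :=
  TensorialAt.mkHom₂ (fun X Y ↦ J.nijenhuisField X Y x) x
    (fun Y _ ↦ J.nijenhuisField_tensorial x Y) (fun X _ ↦ J.nijenhuisField_tensorial' x X)

/-- The tensor `J N_J`, `(X, Y) ↦ J (N_J(X, Y))`. -/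
noncomputable def compNijenhuis : BilinearTensor E M := fun x ↦
  IsBilinearMap.toContinuousBilinearMap (𝕜 := ℝ) (f := fun X Y ↦ J x (J.nijenhuis x X Y))
    ⟨by intros; simp, by intros; simp, by intros; simp, by intros; simp⟩

end AlmostComplexStructure

/-! ## Connections on an almost complex manifold -/

namespace Connection

variable {E : Type*} [NormedAddCommGroup E] [NormedSpace ℝ E] [FiniteDimensional ℝ E]
  {M : Type*} [TopologicalSpace M] [ChartedSpace E M] [IsManifold 𝓘(ℝ, E) ∞ M]

/-- The torsion tensor `T(X, Y) = ∇_X Y - ∇_Y X - [X, Y]`. -/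
noncomputable def torsionTensor (cov : Connection E M) : BilinearTensor E M :=
  have : CompleteSpace E := FiniteDimensional.complete ℝ E
  CovariantDerivative.torsion cov

/-- The connection `∇ - T/2`. -/
noncomputable def symmetrization (cov : Connection E M) : Connection E M :=
  CovariantDerivative.addOneForm cov fun x ↦
    IsBilinearMap.toContinuousBilinearMap (𝕜 := ℝ)
      (f := fun Y X ↦ -((1 / 2 : ℝ) • torsionTensor cov x X Y))
      ⟨by intros; simp only [map_add]; module,
        by intros; simp only [map_smul]; module,
        by intros; simp only [map_add, add_apply]; module,
        by intros; simp only [map_smul, smul_apply]; module⟩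

/-- `∇_X (JY) - J ∇_X Y` at `x`. -/
noncomputable def nablaField (cov : Connection E M) (J : AlmostComplexStructure E M)
    (X Y : ∀ x : M, TangentSpace 𝓘(ℝ, E) x) (x : M) : TangentSpace 𝓘(ℝ, E) x :=
  cov.toFun (J.onField Y) x (X x) - J x (cov.toFun Y x (X x))

/-- The tensor `∇J`, with `(∇J)(X, Y) = ∇_X (JY) - J ∇_X Y`. -/
noncomputable def nabla (cov : Connection E M) (J : AlmostComplexStructure E M) :
    BilinearTensor E M := fun x ↦
  TensorialAt.mkHom₂ (I := 𝓘(ℝ, E)) (F := E) (F' := E) (fun X Y ↦ nablaField cov J X Y x) x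
    (fun Y _ ↦
      { smul := fun {f X} _ _ ↦ by simp [nablaField, smul_sub]
        add := fun {X X'} _ _ ↦ by simp only [nablaField, Pi.add_apply, map_add]; abel })
    (fun X _ ↦
      { smul := fun {f Y} hf hY ↦ by
          simp only [nablaField, J.onField_smul]
          rw [cov.isCovariantDerivativeOnUniv.leibniz (J.mdifferentiableAt_onField hY) hf,
            cov.isCovariantDerivativeOnUniv.leibniz hY hf]
          simp only [add_apply, smul_apply, ContinuousLinearMap.smulRight_apply, map_add, map_smul,
            AlmostComplexStructure.onField]
          module
        add := fun {Y Y'} hY hY' ↦ by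
          simp only [nablaField, J.onField_add]
          rw [cov.isCovariantDerivativeOnUniv.add (J.mdifferentiableAt_onField hY)
            (J.mdifferentiableAt_onField hY'), cov.isCovariantDerivativeOnUniv.add hY hY']
          simp only [add_apply, map_add]
          abel })

/-- The tensor `[∇J](X, Y) = -(∇J)(X, Y) + (∇J)(Y, X)`. -/
noncomputable def bracketNabla (cov : Connection E M) (J : AlmostComplexStructure E M) :
    BilinearTensor E M := fun x ↦
  IsBilinearMap.toContinuousBilinearMap (𝕜 := ℝ)
    (f := fun X Y ↦ -(nabla cov J x X Y) + nabla cov J x Y X)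
    ⟨by intros; simp; abel, by intros; simp, by intros; simp; abel, by intros; simp⟩

/-- The tensor `S(X, Y) = -(∇J)(X, Y) + (∇J)(Y, X) + T(JX, Y) - J T(X, Y)`. -/
noncomputable def tensorS (cov : Connection E M) (J : AlmostComplexStructure E M) :
    BilinearTensor E M := fun x ↦
  IsBilinearMap.toContinuousBilinearMap (𝕜 := ℝ)
    (f := fun X Y ↦ -(nabla cov J x X Y) + nabla cov J x Y X
      + torsionTensor cov x (J x X) Y - J x (torsionTensor cov x X Y))
    ⟨by intros; simp; abel, by intros; simp [smul_sub], by intros; simp; abel,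
      by intros; simp [smul_sub]⟩

/-- `∇` is almost complex: `∇_X (JY) = J ∇_X Y` for all `X, Y ∈ Γ(TM)`. -/
def IsAlmostComplex (cov : Connection E M) (J : AlmostComplexStructure E M) : Prop :=
  ∀ X Y : ∀ x : M, TangentSpace 𝓘(ℝ, E) x, IsSmoothVectorField X → IsSmoothVectorField Y →
    ∀ x : M, cov.toFun (J.onField Y) x (X x) = J x (cov.toFun Y x (X x))

/-- `∇` is minimal: its torsion is `N_J / 4`. -/
def IsMinimal (cov : Connection E M) (J : AlmostComplexStructure E M) : Prop :=
  ∀ x : M, torsionTensor cov x = (1 / 4 : ℝ) • J.nijenhuis x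

end Connection

/-! ## The geometry of the cotangent bundle -/

namespace CotangentBundle

variable {E : Type*} [NormedAddCommGroup E] [NormedSpace ℝ E]
  {M : Type*} [TopologicalSpace M] [ChartedSpace E M] [IsManifold 𝓘(ℝ, E) ∞ M]

/-- The differential `d_ξ π` of the projection `π : T^*M → M`. -/
noncomputable def dproj (ξ : CotangentBundle E M) :
    ξ.Tangent →L[ℝ] TangentSpace 𝓘(ℝ, E) ξ.proj :=
  mfderiv (cotangentModel E) 𝓘(ℝ, E) (fun ζ : CotangentBundle E M ↦ ζ.proj) ξ

theorem extChart_fst (ξ ζ : CotangentBundle E M) :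
    (extChartAt (cotangentModel E) ξ ζ).1 = extChartAt 𝓘(ℝ, E) ξ.proj ζ.proj := rfl

theorem extChart_snd (ξ ζ : CotangentBundle E M) :
    (extChartAt (cotangentModel E) ξ ζ).2 =
    (ζ.2 : TangentSpace 𝓘(ℝ,E) ζ.proj →L[ℝ] ℝ).comp ((trivializationAt E (TangentSpace 𝓘(ℝ, E)) ξ.proj).symmL ℝ ζ.proj) := by
  change (trivializationAt (E →L[ℝ] ℝ) (CotangentSpace E (M := M)) ξ.proj ζ).2 = _
  rw [hom_trivializationAt_apply]
  ext v
  simp [ContinuousLinearMap.inCoordinates]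

theorem dproj_apply (ξ : CotangentBundle E M) (V : ξ.Tangent) :
    dproj ξ V = V.1 := by
  rw [dproj, MDifferentiableAt.mfderiv (mdifferentiableAt_proj _)]
  have : writtenInExtChartAt (cotangentModel E) 𝓘(ℝ, E) ξ (fun ζ : CotangentBundle E M ↦ ζ.proj)
     =ᶠ[𝓝 (extChartAt (cotangentModel E) ξ ξ)] Prod.fst := by
    filter_upwards [extChartAt_target_mem_nhds (I := cotangentModel E) ξ] with y hy
    simp only [writtenInExtChartAt, Function.comp]
    rw [← extChart_fst, PartialEquiv.right_inv _ hy]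
  rw [ModelWithCorners.range_eq_univ, fderivWithin_univ, this.fderiv_eq, fderiv_fst]
  rfl

/-- The velocity at `t = 0` of the curve `t ↦ ξ + t η` in the fibre of `T^*M` through `ξ`. -/
noncomputable def fibreVelocity (ξ : CotangentBundle E M) (η : CotangentSpace E ξ.proj) :
    ξ.Tangent :=
  mfderiv 𝓘(ℝ, ℝ) (cotangentModel E)
    (fun t : ℝ ↦ (⟨ξ.proj, ξ.2 + t • η⟩ : CotangentBundle E M)) 0 (1 : ℝ)

theorem symmL_self (x : M) (v : E) : (trivializationAt E (TangentSpace 𝓘(ℝ, E)) x).symmL ℝ x v = v := by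
  rw [TangentBundle.symmL_trivializationAt_eq_core (by simp)]
  simpa using! (tangentBundleCore 𝓘(ℝ, E) M).coordChange_self (achart E x) x (mem_chart_source E x) v


theorem fibreVelocity_eq (ξ : CotangentBundle E M) (η : CotangentSpace E ξ.proj) :
    fibreVelocity ξ η = ((0, η) : E × (E →L[ℝ] ℝ)) := by
  have key : ∀ t : ℝ, extChartAt (cotangentModel E) ξ (⟨ξ.proj, ξ.2 + t • η⟩ : CotangentBundle E M)
      = (extChartAt 𝓘(ℝ, E) ξ.proj ξ.proj, (show E →L[ℝ] ℝ from ξ.2) + t • (show E →L[ℝ] ℝ from η)) := by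
    intro t
    refine Prod.ext rfl ?_
    rw [extChart_snd]
    ext v
    change (ξ.2 + t • η) ((trivializationAt E (TangentSpace 𝓘(ℝ, E)) ξ.proj).symmL ℝ ξ.proj v) = _
    rw [symmL_self]; rfl
  have hm : MDifferentiableAt 𝓘(ℝ, ℝ) (cotangentModel E) (fun t : ℝ ↦ (⟨ξ.proj, ξ.2 + t • η⟩ : CotangentBundle E M)) 0 := by
    rw [mdifferentiableAt_totalSpace]
    refine ⟨mdifferentiableAt_const, ?_⟩
    have : (fun t : ℝ ↦ (trivializationAt (E →L[ℝ] ℝ) (CotangentSpace E (M := M)) ξ.proj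
      (⟨ξ.proj, ξ.2 + t • η⟩ : CotangentBundle E M)).2) = fun t ↦ (show E →L[ℝ] ℝ from ξ.2) + t • (show E →L[ℝ] ℝ from η) :=
      funext fun t ↦ congrArg Prod.snd (key t)
    refine MDifferentiableAt.congr_of_eventuallyEq ?_ (Filter.Eventually.of_forall fun t ↦ congrFun this t)
    exact (by fun_prop : DifferentiableAt ℝ (fun t : ℝ ↦ (show E →L[ℝ] ℝ from ξ.2) + t • (show E →L[ℝ] ℝ from η)) 0).mdifferentiableAt
  have hw : writtenInExtChartAt 𝓘(ℝ, ℝ) (cotangentModel E) (0 : ℝ)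
      (fun t : ℝ ↦ (⟨ξ.proj, ξ.2 + t • η⟩ : CotangentBundle E M)) =
      fun t ↦ (extChartAt 𝓘(ℝ, E) ξ.proj ξ.proj, (show E →L[ℝ] ℝ from ξ.2) + t • (show E →L[ℝ] ℝ from η)) :=
    funext fun t ↦ key t
  rw [fibreVelocity, MDifferentiableAt.mfderiv hm, hw, ModelWithCorners.range_eq_univ, fderivWithin_univ]
  have hd : HasFDerivAt (fun t : ℝ ↦ (extChartAt 𝓘(ℝ, E) ξ.proj ξ.proj, (show E →L[ℝ] ℝ from ξ.2) + t • (show E →L[ℝ] ℝ from η)))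
    ((0 : ℝ →L[ℝ] E).prod ((ContinuousLinearMap.id ℝ ℝ).smulRight (show E →L[ℝ] ℝ from η))) (extChartAt 𝓘(ℝ,ℝ) (0:ℝ) (0:ℝ)) :=
    (hasFDerivAt_const _ _).prodMk (((hasFDerivAt_id _).smul_const _).const_add _)
  rw [hd.fderiv]
  exact Prod.ext rfl (one_smul ℝ (show E →L[ℝ] ℝ from η))

/-- The canonical embedding of `T^*_x M` into `T_ξ T^*M` as the vertical space, `x = π(ξ)`. -/
noncomputable def verticalLift (ξ : CotangentBundle E M) :
    CotangentSpace E ξ.proj →ₗ[ℝ] ξ.Tangent where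
  toFun := fibreVelocity ξ
  map_add' η η' := by
    rw [fibreVelocity_eq, fibreVelocity_eq, fibreVelocity_eq]
    exact Prod.ext (add_zero (0 : E)).symm rfl
  map_smul' c η := by
    rw [fibreVelocity_eq, fibreVelocity_eq]
    exact Prod.ext (smul_zero (A := E) c).symm rfl

theorem verticalLift_injective (ξ : CotangentBundle E M) :
    Function.Injective (verticalLift ξ) := by
  refine (injective_iff_map_eq_zero _).2 fun η hη ↦ ?_
  have h : fibreVelocity ξ η = 0 := hη
  rw [fibreVelocity_eq] at h
  exact congrArg Prod.snd h

/-- The Liouville form `θ`, `θ_ξ = ξ ∘ d_ξ π`. -/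
noncomputable def liouville (ξ : CotangentBundle E M) : ξ.Tangent →L[ℝ] ℝ :=
  (ξ.2 : TangentSpace 𝓘(ℝ, E) ξ.proj →L[ℝ] ℝ).comp (dproj ξ)

/-- The one-form `θ(J)` on `T^*M`, `θ(J)_ξ = ξ ∘ J ∘ d_ξ π`. -/
noncomputable def liouvilleOf (J : AlmostComplexStructure E M) (ξ : CotangentBundle E M) :
    ξ.Tangent →L[ℝ] ℝ :=
  ((ξ.2 : TangentSpace 𝓘(ℝ, E) ξ.proj →L[ℝ] ℝ).comp (J ξ.proj)).comp (dproj ξ)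

/-- The canonical symplectic form `ω_st = dθ`. -/
noncomputable def symplecticForm (ξ : CotangentBundle E M) : LinearMap.BilinForm ℝ ξ.Tangent :=
  exteriorDerivative (cotangentModel E) liouville ξ

theorem proj_mem_of_mem_source {ξ ζ : CotangentBundle E M}
    (hζ : ζ ∈ (extChartAt (cotangentModel E) ξ).source) : ζ.proj ∈ (chartAt E ξ.proj).source := by
  rw [extChartAt_source, FiberBundle.chartedSpace_chartAt] at hζ
  simp only [mfld_simps] at hζ
  exact hζ.1.1

theorem liouville_chart (ξ : CotangentBundle E M) {y : E × (E →L[ℝ] ℝ)}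
    (hy : y ∈ (extChartAt (cotangentModel E) ξ).target) :
    (liouville ((extChartAt (cotangentModel E) ξ).symm y)).comp
      (mfderivWithin 𝓘(ℝ, E × (E →L[ℝ] ℝ)) (cotangentModel E)
      (extChartAt (cotangentModel E) ξ).symm (Set.range (cotangentModel E)) y)
    = y.2.comp (ContinuousLinearMap.fst ℝ E (E →L[ℝ] ℝ)) := by
  have hζ : (extChartAt (cotangentModel E) ξ).symm y ∈ (extChartAt (cotangentModel E) ξ).source :=
    PartialEquiv.map_target _ hy
  have hd : MDifferentiableAt 𝓘(ℝ, E × (E →L[ℝ] ℝ)) (cotangentModel E)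
      (extChartAt (cotangentModel E) ξ).symm y := by
    have := mdifferentiableWithinAt_extChartAt_symm (I := cotangentModel E) hy
    rwa [ModelWithCorners.range_eq_univ, mdifferentiableWithinAt_univ] at this
  have hyζ : extChartAt (cotangentModel E) ξ ((extChartAt (cotangentModel E) ξ).symm y) = y :=
    PartialEquiv.right_inv _ hy
  rw [ModelWithCorners.range_eq_univ, mfderivWithin_univ]
  have h2 := extChart_snd ξ ((extChartAt (cotangentModel E) ξ).symm y)
  rw [hyζ] at h2
  have h3 := extChart_fst ξ ((extChartAt (cotangentModel E) ξ).symm y)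
  rw [hyζ] at h3
  have hs : ((extChartAt (cotangentModel E) ξ).symm y).proj ∈ (chartAt E ξ.proj).source :=
    proj_mem_of_mem_source hζ
  have h1 : (dproj ((extChartAt (cotangentModel E) ξ).symm y)).comp
      (mfderiv 𝓘(ℝ, E × (E →L[ℝ] ℝ)) (cotangentModel E)
      (extChartAt (cotangentModel E) ξ).symm y) =
      ((trivializationAt E (TangentSpace 𝓘(ℝ, E) : M → Type _) ξ.proj).symmL ℝ
        ((extChartAt (cotangentModel E) ξ).symm y).proj).comp
        (ContinuousLinearMap.fst ℝ E (E →L[ℝ] ℝ)) := by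
    rw [dproj, ← mfderiv_comp y (mdifferentiableAt_proj _) hd, TangentBundle.symmL_trivializationAt hs, ← h3]
    rw [ModelWithCorners.range_eq_univ, mfderivWithin_univ]
    have hy1 : y.1 ∈ (extChartAt 𝓘(ℝ, E) ξ.proj).target := by
      rw [h3]; exact (extChartAt 𝓘(ℝ, E) ξ.proj).map_source (by rwa [extChartAt_source])
    have hev : (fun ζ : CotangentBundle E M ↦ ζ.proj) ∘ (extChartAt (cotangentModel E) ξ).symm
        =ᶠ[𝓝 y] (extChartAt 𝓘(ℝ, E) ξ.proj).symm ∘ Prod.fst := by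
      filter_upwards [(isOpen_extChartAt_target (I := cotangentModel E) ξ).mem_nhds hy] with z hz
      have e := extChart_fst ξ ((extChartAt (cotangentModel E) ξ).symm z)
      rw [PartialEquiv.right_inv _ hz] at e
      simp only [Function.comp]
      rw [e, PartialEquiv.left_inv]
      rw [extChartAt_source]
      exact proj_mem_of_mem_source (PartialEquiv.map_target _ hz)
    have hf : HasMFDerivAt 𝓘(ℝ, E × (E →L[ℝ] ℝ)) 𝓘(ℝ, E) Prod.fst y (ContinuousLinearMap.fst ℝ E (E →L[ℝ] ℝ)) :=
      hasFDerivAt_fst.hasMFDerivAt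
    have hsy : MDifferentiableAt 𝓘(ℝ, E) 𝓘(ℝ, E) (extChartAt 𝓘(ℝ, E) ξ.proj).symm y.1 := by
      have := mdifferentiableWithinAt_extChartAt_symm (I := 𝓘(ℝ, E)) hy1
      rwa [ModelWithCorners.range_eq_univ, mdifferentiableWithinAt_univ] at this
    rw [hev.mfderiv_eq]
    exact (HasMFDerivAt.comp y hsy.hasMFDerivAt hf).mfderiv
  exact (congrArg (fun B : (E × (E →L[ℝ] ℝ)) →L[ℝ] E ↦
      (show E →L[ℝ] ℝ from ((extChartAt (cotangentModel E) ξ).symm y).2).comp B) h1).trans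
    (congrArg (fun p : E →L[ℝ] ℝ ↦ p.comp (ContinuousLinearMap.fst ℝ E (E →L[ℝ] ℝ))) h2.symm)

set_option synthInstance.maxHeartbeats 200000 in
theorem symplecticForm_apply (ξ : CotangentBundle E M) (V W : ξ.Tangent) :
    symplecticForm ξ V W = (show E →L[ℝ] ℝ from V.2) W.1 - (show E →L[ℝ] ℝ from W.2) V.1 := by
  have hT : (fun y ↦ (liouville ((extChartAt (cotangentModel E) ξ).symm y)).comp
    (mfderivWithin 𝓘(ℝ, E × (E →L[ℝ] ℝ)) (cotangentModel E)
      (extChartAt (cotangentModel E) ξ).symm (Set.range (cotangentModel E)) y)) =ᶠ[𝓝 (extChartAt (cotangentModel E) ξ ξ)]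
      fun y ↦ y.2.comp (ContinuousLinearMap.fst ℝ E (E →L[ℝ] ℝ)) := by
    filter_upwards [extChartAt_target_mem_nhds (I := cotangentModel E) ξ] with y hy
    exact liouville_chart ξ hy
  let B : (E × (E →L[ℝ] ℝ)) →L[ℝ] ((E × (E →L[ℝ] ℝ)) →L[ℝ] ℝ) :=
    (ContinuousLinearMap.precomp ℝ (ContinuousLinearMap.fst ℝ E (E →L[ℝ] ℝ))).comp (ContinuousLinearMap.snd ℝ E (E →L[ℝ] ℝ))
  have hd : ∀ p, HasFDerivAt (fun y : E × (E →L[ℝ] ℝ) ↦ y.2.comp (ContinuousLinearMap.fst ℝ E (E →L[ℝ] ℝ)))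
     B p := by
    intro p
    change HasFDerivAt (fun y ↦ B y) B p
    exact ContinuousLinearMap.hasFDerivAt (𝕜 := ℝ) (E := E × (E →L[ℝ] ℝ))
      (F := E × (E →L[ℝ] ℝ) →L[ℝ] ℝ) B
  simp only [symplecticForm, exteriorDerivative, LinearMap.mk₂_apply, mfderiv_extChartAt_self]
  rw [ModelWithCorners.range_eq_univ, fderivWithin_univ]
  rw [ModelWithCorners.range_eq_univ] at hT
  rw [hT.fderiv_eq, (hd _).fderiv]
  rfl

theorem symplecticForm_nondegenerate (ξ : CotangentBundle E M) :
    (symplecticForm ξ).Nondegenerate := by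
  constructor
  · intro V hV
    have h : ∀ W : E × (E →L[ℝ] ℝ), (show E →L[ℝ] ℝ from V.2) W.1 - W.2 V.1 = 0 := fun W ↦
      (symplecticForm_apply ξ V W).symm.trans (hV W)
    refine Prod.ext ?_ ?_
    · change (V.1 : E) = 0
      by_contra hne
      obtain ⟨q, hq⟩ := SeparatingDual.exists_eq_one (R := ℝ) (V := E) hne
      have h2 := h (0, q)
      rw [map_zero, hq] at h2
      norm_num at h2
    · refine ContinuousLinearMap.ext fun v : E ↦ ?_
      exact (sub_zero _).symm.trans (h (v, 0))
  · intro V hV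
    have h : ∀ W : E × (E →L[ℝ] ℝ), W.2 V.1 - (show E →L[ℝ] ℝ from V.2) W.1 = 0 := fun W ↦
      (symplecticForm_apply ξ W V).symm.trans (hV W)
    refine Prod.ext ?_ ?_
    · change (V.1 : E) = 0
      by_contra hne
      obtain ⟨q, hq⟩ := SeparatingDual.exists_eq_one (R := ℝ) (V := E) hne
      have h2 := h (0, q)
      rw [map_zero, hq] at h2
      norm_num at h2
    · refine ContinuousLinearMap.ext fun v : E ↦ ?_
      exact neg_eq_zero.1 ((zero_sub _).symm.trans (h (v, 0)))

/-- The contraction `γ(R)` of a tensor `R`: the endomorphism field of `T T^*M` that maps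
`V ∈ T_ξ T^*M` to the vertical lift of the covector `Z ↦ ξ(R(d_ξ π V, Z))`. -/
noncomputable def gamma (R : BilinearTensor E M) : CotangentEndomorphism E M := fun ξ ↦
  verticalLift ξ ∘ₗ
    { toFun := fun V ↦ (ξ.2 : TangentSpace 𝓘(ℝ, E) ξ.proj →L[ℝ] ℝ).comp (R ξ.proj (dproj ξ V))
      map_add' := fun V W ↦ by rw [(dproj ξ).map_add, (R ξ.proj).map_add]; ext; simp
      map_smul' := fun c V ↦ by rw [(dproj ξ).map_smul, (R ξ.proj).map_smul]; ext; simp }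

end CotangentBundle

/-! ## The horizontal distribution of a connection -/

namespace Connection

open CotangentBundle

variable {E : Type*} [NormedAddCommGroup E] [NormedSpace ℝ E]
  {M : Type*} [TopologicalSpace M] [ChartedSpace E M] [IsManifold 𝓘(ℝ, E) ∞ M]

/-- The induced connection on `T^*M`, paired with a vector field:
`(∇_X s)(Y) = X.s(Y) - s(∇_X Y)` at `x`. -/
noncomputable def dualDerivative (cov : Connection E M)
    (s : ∀ x : M, CotangentSpace E x) (x : M) (X : TangentSpace 𝓘(ℝ, E) x)
    (Y : ∀ x : M, TangentSpace 𝓘(ℝ, E) x) : ℝ :=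
  mvfderiv 𝓘(ℝ, E) (fun x' ↦ s x' (Y x')) x X - s x (cov.toFun Y x X)

/-- The set `H_ξ` of all `d_x s(X)`, where `x = π(ξ)`, `X ∈ T_x M`, `s ∈ Γ(T^*M)`, `s(x) = ξ` and
`∇_X s = 0`. -/
def horizontalSet (cov : Connection E M) (ξ : CotangentBundle E M) : Set ξ.Tangent :=
  {V | ∃ s : ∀ x : M, CotangentSpace E x, IsSmoothCovectorField s ∧ s ξ.proj = ξ.2 ∧
    ∃ X : TangentSpace 𝓘(ℝ, E) ξ.proj,
      (∀ Y, IsSmoothVectorField Y → dualDerivative cov s ξ.proj X Y = 0) ∧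
      V = mfderiv 𝓘(ℝ, E) (cotangentModel E)
        (fun x ↦ TotalSpace.mk' (E →L[ℝ] ℝ) x (s x)) ξ.proj X}

variable (cov : Connection E M)

theorem mdiff_pair {s : ∀ x : M, CotangentSpace E x} {x : M}
    (hs : MDifferentiableAt 𝓘(ℝ, E) (cotangentModel E) (fun x ↦ TotalSpace.mk' (E →L[ℝ] ℝ) x (s x)) x) {Y : ∀ x : M, TangentSpace 𝓘(ℝ, E) x} (hY : MDiffAt (T% Y) x) :
    MDiffAt (fun x' ↦ s x' (Y x')) x := by
  have := MDifferentiableAt.clm_bundle_apply (E₂ := fun _ : M ↦ ℝ) hs hY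
  rw [mdifferentiableAt_section] at this
  exact this

theorem dualDerivative_tensorial {s : ∀ x : M, CotangentSpace E x} {x : M}
    (hs : MDifferentiableAt 𝓘(ℝ, E) (cotangentModel E) (fun x ↦ TotalSpace.mk' (E →L[ℝ] ℝ) x (s x)) x) (X : TangentSpace 𝓘(ℝ, E) x) :
    TensorialAt 𝓘(ℝ, E) E (dualDerivative cov s x X) x where
  smul {f Y} hf hY := by
    have h := mdiff_pair hs hY
    have e : (fun x' ↦ s x' ((f • Y) x')) = f • fun x' ↦ s x' (Y x') := by
      funext x'; simp
    rw [dualDerivative, e, mvfderiv_smul hf h, cov.isCovariantDerivativeOnUniv.leibniz hY hf]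
    simp [dualDerivative]
    ring
  add {Y Y'} hY hY' := by
    have e : (fun x' ↦ s x' ((Y + Y') x')) = (fun x' ↦ s x' (Y x')) + fun x' ↦ s x' (Y' x') := by
      funext x'; simp
    rw [dualDerivative, e, mvfderiv_add (mdiff_pair hs hY) (mdiff_pair hs hY'),
      cov.isCovariantDerivativeOnUniv.add hY hY']
    simp [dualDerivative]
    ring

theorem exists_global {F : Type*} [NormedAddCommGroup F] [NormedSpace ℝ F]
  {V : M → Type*} [TopologicalSpace (TotalSpace F V)]
  [∀ x, AddCommGroup (V x)] [∀ x, Module ℝ (V x)]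
  [∀ x : M, TopologicalSpace (V x)]
  [FiberBundle F V] [VectorBundle ℝ F V] [ContMDiffVectorBundle ∞ F V 𝓘(ℝ, E)] [FiniteDimensional ℝ E]
  [T2Space M] (x : M) (v : V x) : ∃ σ : ∀ x, V x, ContMDiff 𝓘(ℝ, E) (𝓘(ℝ, E).prod 𝓘(ℝ, F)) ∞ (fun x ↦ TotalSpace.mk' F x (σ x))
    ∧ ∀ᶠ x' in 𝓝 x, σ x' = FiberBundle.extend F v x' := by
  obtain ⟨f, -, hf⟩ := (SmoothBumpFunction.nhds_basis_tsupport (I := 𝓘(ℝ, E)) x).mem_iff.1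
    ((trivializationAt F V x).open_baseSet.mem_nhds (FiberBundle.mem_baseSet_trivializationAt' x))
  refine ⟨fun x' ↦ f x' • FiberBundle.extend F v x', ?_, ?_⟩
  · have h : ContMDiffOn 𝓘(ℝ, E) (𝓘(ℝ, E).prod 𝓘(ℝ, F)) ∞ (fun x' ↦ TotalSpace.mk' F x' (FiberBundle.extend F v x')) (trivializationAt F V x).baseSet := by
      rw [(trivializationAt F V x).contMDiffOn_section_baseSet_iff]
      have : ContMDiffOn 𝓘(ℝ, E) 𝓘(ℝ, F) ∞ (fun _ : M ↦ (trivializationAt F V x ⟨x, v⟩).2) (trivializationAt F V x).baseSet :=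
        contMDiffOn_const
      exact this.congr (fun x hx ↦ by simp [FiberBundle.extend, hx])
    exact ContMDiffOn.smul_section_of_tsupport f.contMDiff.contMDiffOn (trivializationAt F V x).open_baseSet hf h
  · filter_upwards [f.eventuallyEq_one] with x' hx'
    simp [hx']

theorem exists_coord [FiniteDimensional ℝ E] [T2Space M] (x : M) (X : TangentSpace 𝓘(ℝ, E) x) (hX : X ≠ 0) :
    ∃ b : M → ℝ, ContMDiff 𝓘(ℝ, E) 𝓘(ℝ, ℝ) ∞ b ∧ b x = 0 ∧ mvfderiv 𝓘(ℝ, E) b x X = 1 := by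
  obtain ⟨ℓ, hℓ⟩ : ∃ ℓ : E →L[ℝ] ℝ, ℓ X = 1 := SeparatingDual.exists_eq_one (R := ℝ) (V := E) hX
  let f : SmoothBumpFunction 𝓘(ℝ, E) x := Classical.arbitrary _
  let g : M → ℝ := fun x' ↦ ℓ (extChartAt 𝓘(ℝ, E) x x' - extChartAt 𝓘(ℝ, E) x x)
  have hg : ContMDiffOn 𝓘(ℝ, E) 𝓘(ℝ, ℝ) ∞ g (chartAt E x).source :=
    ℓ.contMDiff.comp_contMDiffOn ((contMDiffOn_extChartAt (n := ∞)).sub contMDiffOn_const)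
  refine ⟨fun x' ↦ f x' • g x', f.contMDiff_smul hg, by simp [g], ?_⟩
  have hgx : HasMFDerivAt 𝓘(ℝ, E) 𝓘(ℝ, ℝ) g x ℓ := by
    have h1 : HasMFDerivAt 𝓘(ℝ, E) 𝓘(ℝ, E) (extChartAt 𝓘(ℝ, E) x) x (ContinuousLinearMap.id ℝ E) := by
      have := (mdifferentiableAt_extChartAt (I := 𝓘(ℝ, E)) (mem_chart_source E x)).hasMFDerivAt
      rwa [mfderiv_extChartAt_self] at this
    have h2 : HasFDerivAt (fun y ↦ ℓ (y - extChartAt 𝓘(ℝ, E) x x)) ℓ (extChartAt 𝓘(ℝ, E) x x) :=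
      ℓ.hasFDerivAt.comp _ ((hasFDerivAt_id _).sub_const _)
    exact HasMFDerivAt.comp x h2.hasMFDerivAt h1
  have he : (fun x' ↦ f x' • g x') =ᶠ[𝓝 x] g := by
    filter_upwards [f.eventuallyEq_one] with x' hx'
    simp [hx']
  rw [mvfderiv, he.mfderiv_eq, hgx.mfderiv]
  exact hℓ

theorem extend_eq (x : M) (Z : TangentSpace 𝓘(ℝ, E) x) {x' : M}
    (hx' : x' ∈ (trivializationAt E (TangentSpace 𝓘(ℝ, E)) x).baseSet) : FiberBundle.extend E Z x' =
    (trivializationAt E (TangentSpace 𝓘(ℝ, E)) x).symmL ℝ x' Z := by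
  have : (trivializationAt E (TangentSpace 𝓘(ℝ, E)) x ⟨x, Z⟩).2 = Z := by
    rw [← Trivialization.continuousLinearMapAt_apply_of_mem (R := ℝ) _
      (FiberBundle.mem_baseSet_trivializationAt' x),
      TangentBundle.continuousLinearMapAt_trivializationAt (mem_chart_source E x),
      mfderiv_extChartAt_self]
    rfl
  rw [FiberBundle.extend, this]
  exact (Trivialization.symmL_apply _ hx' _).symm

theorem mfderiv_section {s : ∀ x : M, CotangentSpace E x} {x : M}
    (hs : MDifferentiableAt 𝓘(ℝ, E) (cotangentModel E) (fun x ↦ TotalSpace.mk' (E →L[ℝ] ℝ) x (s x)) x)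
    (X : TangentSpace 𝓘(ℝ, E) x) :
    ∃ q : E →L[ℝ] ℝ, (mfderiv 𝓘(ℝ, E) (cotangentModel E) (fun x ↦ TotalSpace.mk' (E →L[ℝ] ℝ) x (s x)) x X
      : E × (E →L[ℝ] ℝ)) = (X, q) ∧
     ∀ Z : TangentSpace 𝓘(ℝ, E) x, q Z = mvfderiv 𝓘(ℝ, E) (fun x' ↦ s x' (FiberBundle.extend E Z x')) x X := by
  set f : M → CotangentBundle E M := fun x ↦ TotalSpace.mk' (E →L[ℝ] ℝ) x (s x) with hf
  have hd := hs.hasMFDerivAt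
  have hφ : HasMFDerivAt (cotangentModel E) 𝓘(ℝ, E × (E →L[ℝ] ℝ)) (extChartAt (cotangentModel E) (f x)) (f x)
      (ContinuousLinearMap.id ℝ (E × (E →L[ℝ] ℝ))) := by
    have := (mdifferentiableAt_extChartAt (I := cotangentModel E) (mem_chart_source (ModelProd E (E →L[ℝ] ℝ)) (f x))).hasMFDerivAt
    rwa [mfderiv_extChartAt_self] at this
  have hc := HasMFDerivAt.comp x hφ hd
  refine ⟨(mfderiv 𝓘(ℝ, E) (cotangentModel E) f x X : E × (E →L[ℝ] ℝ)).2, Prod.ext ?_ rfl, ?_⟩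
  · change _ = X
    rw [← dproj_apply (f x)]
    have hp : HasMFDerivAt (cotangentModel E) 𝓘(ℝ, E) (fun ζ : CotangentBundle E M ↦ ζ.proj) (f x)
        (dproj (f x)) := (mdifferentiableAt_proj _).hasMFDerivAt
    have h1 := hasMFDerivAt_unique (HasMFDerivAt.comp x hp hd) (hasMFDerivAt_id x)
    exact congrArg (fun B : E →L[ℝ] E ↦ B X) h1
  · intro Z
    let ev : (E × (E →L[ℝ] ℝ)) →L[ℝ] ℝ := (ContinuousLinearMap.apply ℝ ℝ (show E from Z)).comp (ContinuousLinearMap.snd ℝ E (E →L[ℝ] ℝ))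
    have hev : HasMFDerivAt 𝓘(ℝ, E × (E →L[ℝ] ℝ)) 𝓘(ℝ, ℝ) ev (extChartAt (cotangentModel E) (f x) (f x)) ev :=
      (ContinuousLinearMap.hasFDerivAt (𝕜 := ℝ) (E := E × (E →L[ℝ] ℝ)) (F := ℝ) ev).hasMFDerivAt
    have hcc := HasMFDerivAt.comp x hev hc
    have heq : (ev ∘ (extChartAt (cotangentModel E) (f x)) ∘ f) =ᶠ[𝓝 x] fun x' ↦ s x' (FiberBundle.extend E Z x') := by
      filter_upwards [(trivializationAt E (TangentSpace 𝓘(ℝ, E)) x).open_baseSet.mem_nhds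
        (FiberBundle.mem_baseSet_trivializationAt' x)] with x' hx'
      change (extChartAt (cotangentModel E) (f x) (f x')).2 Z = _
      rw [extChart_snd, extend_eq x Z hx']
      rfl
    rw [mvfderiv, ← heq.mfderiv_eq, hcc.mfderiv]
    rfl

theorem extend_pair (x : M) (η : CotangentSpace E x) (Z : TangentSpace 𝓘(ℝ, E) x) {x' : M}
    (hx' : x' ∈ (trivializationAt E (TangentSpace 𝓘(ℝ, E)) x).baseSet) :
    (FiberBundle.extend (E →L[ℝ] ℝ) η x' : CotangentSpace E x') (FiberBundle.extend E Z x') = η Z := by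
  have hb : x' ∈ (trivializationAt (E →L[ℝ] ℝ) (CotangentSpace E (M := M)) x).baseSet := ⟨hx', trivial⟩
  have e1 : (trivializationAt (E →L[ℝ] ℝ) (CotangentSpace E (M := M)) x ⟨x', FiberBundle.extend (E →L[ℝ] ℝ) η x'⟩).2
     = (trivializationAt (E →L[ℝ] ℝ) (CotangentSpace E (M := M)) x ⟨x, η⟩).2 := by
    rw [FiberBundle.extend]
    rw [Trivialization.apply_mk_symm _ hb]
  have k1 := extChart_snd (⟨x, η⟩ : CotangentBundle E M) ⟨x', FiberBundle.extend (E →L[ℝ] ℝ) η x'⟩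
  have k2 := extChart_snd (⟨x, η⟩ : CotangentBundle E M) ⟨x, η⟩
  have k3 := k1.symm.trans ((show _ = _ from e1).trans k2)
  have k4 := congrArg (fun p : E →L[ℝ] ℝ ↦ p Z) k3
  rw [extend_eq x Z hx']
  refine k4.trans ?_
  change η ((trivializationAt E (TangentSpace 𝓘(ℝ, E)) x).symmL ℝ x Z) = η Z
  exact congrArg (fun z : E ↦ (show E →L[ℝ] ℝ from η) z) (symmL_self (E := E) x Z)

variable [FiniteDimensional ℝ E] [T2Space M]

theorem exists_section (x : M) (η p : CotangentSpace E x) (X : TangentSpace 𝓘(ℝ, E) x) (h : X = 0 → p = 0) :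
    ∃ s : ∀ x : M, CotangentSpace E x, IsSmoothCovectorField s ∧ s x = η ∧
      ∀ Z : TangentSpace 𝓘(ℝ, E) x, mvfderiv 𝓘(ℝ, E) (fun x' ↦ s x' (FiberBundle.extend E Z x')) x X = p Z := by
  obtain ⟨σ, hσ, hσe⟩ := exists_global (E := E) (F := E →L[ℝ] ℝ) (V := CotangentSpace E (M := M)) x η
  obtain ⟨τ, hτ, hτe⟩ := exists_global (E := E) (F := E →L[ℝ] ℝ) (V := CotangentSpace E (M := M)) x p
  obtain ⟨b, hb, hb0, hbX⟩ : ∃ b : M → ℝ, ContMDiff 𝓘(ℝ, E) 𝓘(ℝ, ℝ) ∞ b ∧ b x = 0 ∧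
      ∀ Z : TangentSpace 𝓘(ℝ, E) x, mvfderiv 𝓘(ℝ, E) b x X * p Z = p Z := by
    by_cases hV : X = 0
    · refine ⟨fun _ ↦ 0, contMDiff_const, rfl, fun Z ↦ ?_⟩
      rw [h hV]; simp
    · obtain ⟨b, h1, h2, h3⟩ := exists_coord x X hV
      refine ⟨b, h1, h2, fun Z ↦ ?_⟩
      rw [h3, one_mul]
  refine ⟨σ + b • τ, hσ.add_section (hb.smul_section hτ), ?_, fun Z ↦ ?_⟩
  · simp [hb0, hσe.self_of_nhds]
  · have he : (fun x' ↦ (σ + b • τ) x' (FiberBundle.extend E Z x')) =ᶠ[𝓝 x]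
        ((fun r : ℝ ↦ η Z + r * p Z) ∘ b) := by
      filter_upwards [(trivializationAt E (TangentSpace 𝓘(ℝ, E)) x).open_baseSet.mem_nhds
        (FiberBundle.mem_baseSet_trivializationAt' x), hσe, hτe] with x' hx' h1 h2
      simp only [Pi.add_apply, Pi.smul_apply', h1, h2, add_apply, smul_apply, smul_eq_mul, Function.comp]
      rw [extend_pair _ _ _ hx', extend_pair _ _ _ hx']
    have hm : HasMFDerivAt 𝓘(ℝ, E) 𝓘(ℝ, ℝ) b x (mfderiv 𝓘(ℝ, E) 𝓘(ℝ, ℝ) b x) :=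
      (hb.contMDiffAt.mdifferentiableAt (by simp)).hasMFDerivAt
    have hl : HasFDerivAt (fun r : ℝ ↦ η Z + r * p Z)
        ((ContinuousLinearMap.id ℝ ℝ).smulRight (p Z)) (b x) :=
      ((hasFDerivAt_id _).mul_const' _).const_add _
    rw [mvfderiv, he.mfderiv_eq, (HasMFDerivAt.comp x hl.hasMFDerivAt hm).mfderiv]
    exact hbX Z

theorem mem_horizontalSet (ξ : CotangentBundle E M) (X : TangentSpace 𝓘(ℝ, E) ξ.proj) (p : CotangentSpace E ξ.proj) :
   ((X, p) : E × (E →L[ℝ] ℝ)) ∈ horizontalSet cov ξ ↔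
    ∀ Z : TangentSpace 𝓘(ℝ, E) ξ.proj, p Z = ξ.2 (cov.toFun (FiberBundle.extend E Z) ξ.proj X) := by
  constructor
  · rintro ⟨s, hs, hsx, X', hX, he⟩ Z
    have hs' := hs.contMDiffAt.mdifferentiableAt (x := ξ.proj) (by simp)
    obtain ⟨q, hq, hqZ⟩ := mfderiv_section hs' X'
    obtain ⟨Y, hY, hYe⟩ := exists_global (E := E) (F := E) (V := (TangentSpace 𝓘(ℝ, E) : M → Type _)) ξ.proj Z
    have h1 := (dualDerivative_tensorial cov hs' X').pointwise (hY.contMDiffAt.mdifferentiableAt (by simp))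
      (FiberBundle.mdifferentiableAt_extend 𝓘(ℝ, E) E Z) hYe.self_of_nhds
    rw [hX Y hY] at h1
    have h6 := he.trans hq
    obtain rfl : X = X' := congrArg Prod.fst h6
    obtain rfl : p = q := congrArg Prod.snd h6
    refine (hqZ Z).trans ?_
    rw [← hsx]
    exact (sub_eq_zero.1 h1.symm)
  · intro h
    obtain ⟨s, hs, hsx, hsp⟩ := exists_section ξ.proj ξ.2 p X (fun hX ↦ by
      ext Z
      rw [h Z, hX, map_zero, map_zero]; rfl)
    have hs' := hs.contMDiffAt.mdifferentiableAt (x := ξ.proj) (by simp)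
    obtain ⟨q, hq, hqZ⟩ := mfderiv_section hs' X
    have hqV : q = p := ContinuousLinearMap.ext fun (Z : TangentSpace 𝓘(ℝ, E) ξ.proj) ↦ (hqZ Z).trans (hsp Z)
    refine ⟨s, hs, hsx, X, fun Y hY ↦ ?_, ?_⟩
    · have h5 := (dualDerivative_tensorial cov hs' X).pointwise (hY.contMDiffAt.mdifferentiableAt (by simp))
        (FiberBundle.mdifferentiableAt_extend 𝓘(ℝ, E) E (Y ξ.proj)) (by simp)
      rw [h5]
      simp only [dualDerivative]
      rw [hsp, h, hsx, sub_self]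
    · exact (hq.trans (congrArg _ hqV)).symm

/-- The covectors `Z ↦ ξ(∇_X Z)`, as a linear function of `X`, in the preferred chart. -/
theorem exists_horizontal (ξ : CotangentBundle E M) (X : TangentSpace 𝓘(ℝ, E) ξ.proj) :
    ∃ p : CotangentSpace E ξ.proj, ∀ Z : TangentSpace 𝓘(ℝ, E) ξ.proj,
      p Z = ξ.2 (cov.toFun (FiberBundle.extend E Z) ξ.proj X) := by
  obtain ⟨s, hs, hsx, hsp⟩ := exists_section ξ.proj ξ.2 0 X (fun _ ↦ rfl)
  have hs' := hs.contMDiffAt.mdifferentiableAt (x := ξ.proj) (by simp)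
  refine ⟨-(TensorialAt.mkHom (dualDerivative cov s ξ.proj X) ξ.proj
    (dualDerivative_tensorial cov hs' X)), fun Z ↦ ?_⟩
  rw [neg_apply, TensorialAt.mkHom_apply_eq_extend, dualDerivative, hsp, hsx]
  simp

/-- The horizontal distribution `H^∇`. -/
def horizontalSpace (ξ : CotangentBundle E M) : Submodule ℝ ξ.Tangent where
  carrier := horizontalSet cov ξ
  zero_mem' := (mem_horizontalSet cov ξ 0 0).2 fun Z ↦ by simp
  add_mem' {V W} hV hW := (mem_horizontalSet cov ξ (V.1 + W.1) (V.2 + W.2)).2 fun Z ↦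
    (congrArg₂ (· + ·) ((mem_horizontalSet cov ξ V.1 V.2).1 hV Z)
      ((mem_horizontalSet cov ξ W.1 W.2).1 hW Z)).trans
      (((ξ.2 : TangentSpace 𝓘(ℝ, E) ξ.proj →L[ℝ] ℝ).comp
        (cov.toFun (FiberBundle.extend E Z) ξ.proj)).map_add V.1 W.1).symm
  smul_mem' c V hV := (mem_horizontalSet cov ξ (c • V.1) (c • V.2)).2 fun Z ↦
    (congrArg (c • ·) ((mem_horizontalSet cov ξ V.1 V.2).1 hV Z)).trans
      (((ξ.2 : TangentSpace 𝓘(ℝ, E) ξ.proj →L[ℝ] ℝ).comp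
        (cov.toFun (FiberBundle.extend E Z) ξ.proj)).map_smul c V.1).symm

theorem bijective_dproj_horizontal (ξ : CotangentBundle E M) :
    Function.Bijective ((dproj ξ).toLinearMap ∘ₗ (horizontalSpace cov ξ).subtype) := by
  constructor
  · rintro ⟨V, hV⟩ ⟨W, hW⟩ h
    have h1 : V.1 = W.1 := by
      rw [← dproj_apply, ← dproj_apply]; exact h
    refine Subtype.ext (Prod.ext h1 ?_)
    refine ContinuousLinearMap.ext fun Z ↦ ?_
    refine ((mem_horizontalSet cov ξ V.1 V.2).1 hV Z).trans ?_
    rw [h1]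
    exact ((mem_horizontalSet cov ξ W.1 W.2).1 hW Z).symm
  · intro X
    obtain ⟨p, hp⟩ := exists_horizontal cov ξ X
    exact ⟨⟨((X, p) : E × (E →L[ℝ] ℝ)), (mem_horizontalSet cov ξ X p).2 hp⟩, dproj_apply ξ _⟩

theorem isCompl_vertical_horizontal (ξ : CotangentBundle E M) :
    IsCompl (LinearMap.range (verticalLift ξ)) (horizontalSpace cov ξ) := by
  have hd : ∀ η, dproj ξ (verticalLift ξ η) = 0 := fun η ↦ by
    rw [dproj_apply]
    exact congrArg Prod.fst (fibreVelocity_eq ξ η)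
  constructor
  · rw [Submodule.disjoint_def]
    rintro _ ⟨η, rfl⟩ hH
    have := (bijective_dproj_horizontal cov ξ).1 (a₁ := ⟨_, hH⟩) (a₂ := 0)
      ((hd η).trans (LinearMap.map_zero _).symm)
    exact congrArg Subtype.val this
  · rw [codisjoint_iff, Submodule.eq_top_iff']
    intro V
    obtain ⟨W, hW⟩ := (bijective_dproj_horizontal cov ξ).2 (dproj ξ V)
    have hW1 : dproj ξ W.1 = dproj ξ V := hW
    rw [dproj_apply, dproj_apply] at hW1
    refine Submodule.mem_sup.2 ⟨V - W.1, ⟨V.2 - W.1.2, ?_⟩, W.1, W.2, sub_add_cancel _ _⟩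
    refine (fibreVelocity_eq ξ _).trans (Prod.ext ?_ rfl)
    exact (sub_eq_zero.2 hW1.symm).symm

/-- The inverse of the isomorphism `d_ξ π : H^∇_ξ → T_x M`, with values in `T_ξ T^*M`. -/
noncomputable def horizontalLift (ξ : CotangentBundle E M) :
    TangentSpace 𝓘(ℝ, E) ξ.proj →ₗ[ℝ] ξ.Tangent :=
  (horizontalSpace cov ξ).subtype ∘ₗ
    (LinearEquiv.ofBijective _ (bijective_dproj_horizontal cov ξ)).symm.toLinearMap

/-- The projection `v^∇ : T_ξ T^*M → T^*_x M` onto the vertical space, parallel to `H^∇_ξ`. -/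
noncomputable def verticalProjection (ξ : CotangentBundle E M) :
    ξ.Tangent →ₗ[ℝ] CotangentSpace E ξ.proj :=
  LinearMap.linearProjOfIsCompl (horizontalSpace cov ξ) (verticalLift ξ)
    (verticalLift_injective ξ) (isCompl_vertical_horizontal cov ξ)

end Connection

/-! ## The lifts of an almost complex structure to the cotangent bundle -/

namespace AlmostComplexStructure

open CotangentBundle Connection

variable {E : Type*} [NormedAddCommGroup E] [NormedSpace ℝ E] [FiniteDimensional ℝ E]
  {M : Type*} [TopologicalSpace M] [ChartedSpace E M] [IsManifold 𝓘(ℝ, E) ∞ M]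
  (J : AlmostComplexStructure E M)

/-- The endomorphism field `J^c`, determined by `d(θ(J)) = ω_st(J^c ., .)`. -/
noncomputable def completeLift : CotangentEndomorphism E M := fun ξ ↦
  ((symplecticForm ξ).toDual (symplecticForm_nondegenerate ξ)).symm.toLinearMap ∘ₗ
    exteriorDerivative (cotangentModel E) (liouvilleOf J) ξ

/-- `ω_st(J^c V, W) = d(θ(J))(V, W)`. -/
theorem symplecticForm_completeLift (ξ : CotangentBundle E M) (V W : ξ.Tangent) :
    symplecticForm ξ (J.completeLift ξ V) W =
      exteriorDerivative (cotangentModel E) (liouvilleOf J) ξ V W :=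
  LinearMap.BilinForm.apply_toDual_symm_apply
    (hB := symplecticForm_nondegenerate ξ) _ _

/-- The structure `J^c - γ(J N_J) / 2` of Sato. -/
noncomputable def satoLift : CotangentEndomorphism E M :=
  J.completeLift - (1 / 2 : ℝ) • gamma J.compNijenhuis

/-- The horizontal lift `J^{H,∇} = J^c + γ([∇'J])` of Ishihara and Yano, where `∇' = ∇ - T/2`. -/
noncomputable def horizontalLift (cov : Connection E M) : CotangentEndomorphism E M :=
  J.completeLift + gamma (bracketNabla (symmetrization cov) J)

/-- The transpose of `J` at `x`, acting on covectors. -/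
noncomputable def transpose (x : M) : CotangentSpace E x →ₗ[ℝ] CotangentSpace E x where
  toFun η := η.comp (J x)
  map_add' _ _ := rfl
  map_smul' _ _ := rfl

/-- The generalized horizontal lift `J^{G,∇}`: it is `J ⊕ ᵗJ` in the decomposition
`T_ξ T^*M = H^∇_ξ ⊕ T^*_x M`, where `H^∇_ξ` is identified with `T_x M` by `d_ξ π`. -/
noncomputable def generalizedHorizontalLift [T2Space M] (cov : Connection E M) :
    CotangentEndomorphism E M := fun ξ ↦
  Connection.horizontalLift cov ξ ∘ₗ (J ξ.proj).toLinearMap ∘ₗ (dproj ξ).toLinearMap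
    + verticalLift ξ ∘ₗ J.transpose ξ.proj ∘ₗ verticalProjection cov ξ

end AlmostComplexStructure

/-! All three lifts differ from `J^c` by a term `γ(R)`, and `γ` is injective because covectors at a
point separate tangent vectors (`gamma_injective`). Comparing lifts is therefore comparing tensors
on `M`: `R = -½ J N_J` for Satô's lift, `R = [∇̃J]` for the Ishihara–Yano lift, and, as the main
point, `R = S` for the generalized horizontal lift (`generalizedHorizontalLift_eq`).

The identity `J^G = J^c + γ(S)` is checked at each `ξ` in the preferred chart at `π(ξ)`, where
tangent vectors of `T^*M` are pairs `(X, q)`. Write `Ẑ` for the field with constant coefficients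
extending `Z`, and `p_X(Z) = ξ(∇_X Ẑ)`. The horizontal lift of `X` is `(X, p_X)`, so `J^G (X, q) =
(JX, p_{JX} + (q - p_X) ∘ J)`. The coordinate formula for `d(θ(J))` and nondegeneracy of `ω_st` give
`J^c (X, q) = (JX, q ∘ J + ξ((D_X J) · - (D_· J) X))` (`completeLift_eq`). The difference is
vertical, and its covector is `ξ ∘ S(X, ·)`, since in the chart every derivative term of `S` cancels
except `∇_{JX} Ẑ - ∇_X (JZ)^ - (D_X J) Z + (D_Z J) X` (`tensorS_eq_extend`).

Claim (1) is then injectivity of `γ`. Claim (2) follows from `S(X,Y) - [∇̃J](X,Y) = ½ (T(JX,Y) -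
T(X,JY))`. For (3), `∇J = 0` leaves `S(X,Y) = T(JX,Y) - J T(X,Y)`; with `T = ¼ N_J` and `N_J(JX,Y) =
N_J(X,JY) = -J N_J(X,Y)`, both criteria hold. -/

/-! ### The almost complex structure in a chart -/

namespace AlmostComplexStructure

variable {E : Type*} [NormedAddCommGroup E] [NormedSpace ℝ E]
  {M : Type*} [TopologicalSpace M] [ChartedSpace E M] [IsManifold 𝓘(ℝ, E) ∞ M]
  (J : AlmostComplexStructure E M)

/-- The expression of `J` in the preferred chart at `x`. -/
noncomputable def localExpr (x : M) (y : E) : E →L[ℝ] E :=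
  ContinuousLinearMap.inCoordinates E (TangentSpace 𝓘(ℝ, E)) E (TangentSpace 𝓘(ℝ, E)) x
    ((extChartAt 𝓘(ℝ, E) x).symm y) x ((extChartAt 𝓘(ℝ, E) x).symm y)
    (J ((extChartAt 𝓘(ℝ, E) x).symm y))

theorem differentiableAt_localExpr (x : M) :
    DifferentiableAt ℝ (J.localExpr x) (extChartAt 𝓘(ℝ, E) x x) := by
  -- Smoothness of a section of the Hom bundle means smoothness of its matrix in the trivialization;
  -- composing with the inverse chart moves this to `E`.
  have h := ((contMDiffAt_hom_bundle _).1 (J.contMDiff'.contMDiffAt (x := x))).2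
  have h' := h.mdifferentiableAt (by simp)
  have hs : MDifferentiableAt 𝓘(ℝ, E) 𝓘(ℝ, E) (extChartAt 𝓘(ℝ, E) x).symm
      (extChartAt 𝓘(ℝ, E) x x) := by
    have := mdifferentiableWithinAt_extChartAt_symm (I := 𝓘(ℝ, E)) (mem_extChartAt_target x)
    rwa [ModelWithCorners.range_eq_univ, mdifferentiableWithinAt_univ] at this
  rw [← mdifferentiableAt_iff_differentiableAt]
  refine MDifferentiableAt.comp (I' := 𝓘(ℝ, E)) _ (g := fun x' ↦
    ContinuousLinearMap.inCoordinates E (TangentSpace 𝓘(ℝ, E)) E (TangentSpace 𝓘(ℝ, E))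
      x x' x x' (J x')) ?_ hs
  rw [extChartAt_to_inv]
  exact h'

theorem localExpr_apply (x : M) {x' : M} (hx' : x' ∈ (chartAt E x).source) (v : E) :
    J.localExpr x (extChartAt 𝓘(ℝ, E) x x') v =
      (trivializationAt E (TangentSpace 𝓘(ℝ, E)) x).continuousLinearMapAt ℝ x'
        (J x' ((trivializationAt E (TangentSpace 𝓘(ℝ, E)) x).symmL ℝ x' v)) := by
  rw [localExpr, (extChartAt 𝓘(ℝ, E) x).left_inv (by rwa [extChartAt_source])]
  rfl

/-- This is the form used later: the chart frame intertwines the matrix of `J` with `J` itself, so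
`J` passes through the trivialization without being inverted. -/
theorem symmL_localExpr (x : M) {x' : M} (hx' : x' ∈ (chartAt E x).source) (v : E) :
    (trivializationAt E (TangentSpace 𝓘(ℝ, E)) x).symmL ℝ x'
      (J.localExpr x (extChartAt 𝓘(ℝ, E) x x') v) =
      J x' ((trivializationAt E (TangentSpace 𝓘(ℝ, E)) x).symmL ℝ x' v) := by
  rw [J.localExpr_apply x hx']
  exact Trivialization.symmL_continuousLinearMapAt _ hx' _

theorem localExpr_self (x : M) (v : TangentSpace 𝓘(ℝ, E) x) :
    J.localExpr x (extChartAt 𝓘(ℝ, E) x x) v = J x v := by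
  have h := J.symmL_localExpr x (mem_chart_source E x) v
  rw [CotangentBundle.symmL_self] at h
  exact h.trans (congrArg (J x) (CotangentBundle.symmL_self (E := E) x v))

theorem onField_onField (X : ∀ x : M, TangentSpace 𝓘(ℝ, E) x) :
    J.onField (J.onField X) = (-1 : ℝ) • X := by
  funext x
  simp [onField, J.sq']

end AlmostComplexStructure

/-! ### The form `θ(J)` and its differential in coordinates -/

namespace CotangentBundle

variable {E : Type*} [NormedAddCommGroup E] [NormedSpace ℝ E]
  {M : Type*} [TopologicalSpace M] [ChartedSpace E M] [IsManifold 𝓘(ℝ, E) ∞ M]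
  (J : AlmostComplexStructure E M)

/-- With `K` the matrix of `J`, the differentiated map is `p_k J^k_i dx^i`, the coordinate
expression of `θ(J)`; the two terms come from the product rule. -/
theorem fderiv_snd_comp_comp_fst {K : E → E →L[ℝ] E} {K' : E →L[ℝ] E →L[ℝ] E} {a : E}
    (hK : HasFDerivAt K K' a) (η : E →L[ℝ] ℝ) (A B : E × (E →L[ℝ] ℝ)) :
    fderiv ℝ (fun y : E × (E →L[ℝ] ℝ) ↦
      (y.2.comp (K y.1)).comp (ContinuousLinearMap.fst ℝ E (E →L[ℝ] ℝ))) (a, η) A B =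
      η (K' A.1 B.1) + A.2 (K a B.1) := by
  have hJ : HasFDerivAt (fun y : E × (E →L[ℝ] ℝ) ↦ K y.1)
      (K'.comp (ContinuousLinearMap.fst ℝ E (E →L[ℝ] ℝ))) (a, η) :=
    HasFDerivAt.comp (g := K) (f := Prod.fst) (a, η) hK hasFDerivAt_fst
  have hd := (hasFDerivAt_snd.clm_comp hJ).clm_comp
    (hasFDerivAt_const (ContinuousLinearMap.fst ℝ E (E →L[ℝ] ℝ)) _)
  rw [hd.fderiv]
  simp

/-- In the charts at `ξ` and `π(ξ)` the projection is the first coordinate, and the derivative of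
the inverse chart of `M` is the inverse trivialization of `TM`; the chain rule does the rest. -/
theorem dproj_comp_mfderiv_extChartAt_symm (ξ : CotangentBundle E M) {y : E × (E →L[ℝ] ℝ)}
    (hy : y ∈ (extChartAt (cotangentModel E) ξ).target) :
    (dproj ((extChartAt (cotangentModel E) ξ).symm y)).comp
      (mfderivWithin 𝓘(ℝ, E × (E →L[ℝ] ℝ)) (cotangentModel E)
      (extChartAt (cotangentModel E) ξ).symm (Set.range (cotangentModel E)) y) =
      ((trivializationAt E (TangentSpace 𝓘(ℝ, E) : M → Type _) ξ.proj).symmL ℝ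
        ((extChartAt (cotangentModel E) ξ).symm y).proj).comp
        (ContinuousLinearMap.fst ℝ E (E →L[ℝ] ℝ)) := by
  have hd : MDifferentiableAt 𝓘(ℝ, E × (E →L[ℝ] ℝ)) (cotangentModel E)
      (extChartAt (cotangentModel E) ξ).symm y := by
    have := mdifferentiableWithinAt_extChartAt_symm (I := cotangentModel E) hy
    rwa [ModelWithCorners.range_eq_univ, mdifferentiableWithinAt_univ] at this
  rw [ModelWithCorners.range_eq_univ, mfderivWithin_univ]
  have h3 := extChart_fst ξ ((extChartAt (cotangentModel E) ξ).symm y)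
  rw [PartialEquiv.right_inv _ hy] at h3
  have hs : ((extChartAt (cotangentModel E) ξ).symm y).proj ∈ (chartAt E ξ.proj).source :=
    proj_mem_of_mem_source (PartialEquiv.map_target _ hy)
  rw [dproj, ← mfderiv_comp y (mdifferentiableAt_proj _) hd,
    TangentBundle.symmL_trivializationAt hs, ← h3, ModelWithCorners.range_eq_univ,
    mfderivWithin_univ]
  have hy1 : y.1 ∈ (extChartAt 𝓘(ℝ, E) ξ.proj).target := by
    rw [h3]; exact (extChartAt 𝓘(ℝ, E) ξ.proj).map_source (by rwa [extChartAt_source])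
  have hev : (fun ζ : CotangentBundle E M ↦ ζ.proj) ∘ (extChartAt (cotangentModel E) ξ).symm
      =ᶠ[𝓝 y] (extChartAt 𝓘(ℝ, E) ξ.proj).symm ∘ Prod.fst := by
    filter_upwards [(isOpen_extChartAt_target (I := cotangentModel E) ξ).mem_nhds hy] with z hz
    have e := extChart_fst ξ ((extChartAt (cotangentModel E) ξ).symm z)
    rw [PartialEquiv.right_inv _ hz] at e
    simp only [Function.comp]
    rw [e, PartialEquiv.left_inv]
    rw [extChartAt_source]
    exact proj_mem_of_mem_source (PartialEquiv.map_target _ hz)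
  have hf : HasMFDerivAt 𝓘(ℝ, E × (E →L[ℝ] ℝ)) 𝓘(ℝ, E) Prod.fst y
      (ContinuousLinearMap.fst ℝ E (E →L[ℝ] ℝ)) :=
    hasFDerivAt_fst.hasMFDerivAt
  have hsy : MDifferentiableAt 𝓘(ℝ, E) 𝓘(ℝ, E) (extChartAt 𝓘(ℝ, E) ξ.proj).symm y.1 := by
    have := mdifferentiableWithinAt_extChartAt_symm (I := 𝓘(ℝ, E)) hy1
    rwa [ModelWithCorners.range_eq_univ, mdifferentiableWithinAt_univ] at this
  rw [hev.mfderiv_eq]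
  exact (HasMFDerivAt.comp y hsy.hasMFDerivAt hf).mfderiv

/-- The fibre coordinate `y.2` is the covector composed with the chart frame. Moving `J` across that
frame turns it into its matrix. -/
theorem liouvilleOf_chart (ξ : CotangentBundle E M) {y : E × (E →L[ℝ] ℝ)}
    (hy : y ∈ (extChartAt (cotangentModel E) ξ).target) :
    (liouvilleOf J ((extChartAt (cotangentModel E) ξ).symm y)).comp
      (mfderivWithin 𝓘(ℝ, E × (E →L[ℝ] ℝ)) (cotangentModel E)
      (extChartAt (cotangentModel E) ξ).symm (Set.range (cotangentModel E)) y)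
    = (y.2.comp (J.localExpr ξ.proj y.1)).comp (ContinuousLinearMap.fst ℝ E (E →L[ℝ] ℝ)) := by
  have hs : ((extChartAt (cotangentModel E) ξ).symm y).proj ∈ (chartAt E ξ.proj).source :=
    proj_mem_of_mem_source (PartialEquiv.map_target _ hy)
  have h1 := dproj_comp_mfderiv_extChartAt_symm ξ hy
  have h2 := extChart_snd ξ ((extChartAt (cotangentModel E) ξ).symm y)
  have h3 := extChart_fst ξ ((extChartAt (cotangentModel E) ξ).symm y)
  rw [PartialEquiv.right_inv _ hy] at h2 h3
  refine ContinuousLinearMap.ext fun v ↦ ?_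
  have h4 := J.symmL_localExpr ξ.proj hs v.1
  rw [← h3] at h4
  have h5 := congrArg (fun B : (E × (E →L[ℝ] ℝ)) →L[ℝ] E ↦ B v) h1
  have h6 := congrArg (fun q : E →L[ℝ] ℝ ↦ q (J.localExpr ξ.proj y.1 v.1)) h2
  refine (congrArg (fun w : E ↦ (show E →L[ℝ] ℝ from ((extChartAt (cotangentModel E) ξ).symm y).2)
    (J ((extChartAt (cotangentModel E) ξ).symm y).proj w)) h5).trans ?_
  refine Eq.trans ?_ h6.symm
  exact (congrArg (fun w : E ↦
    (show E →L[ℝ] ℝ from ((extChartAt (cotangentModel E) ξ).symm y).2) w) h4).symm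

theorem extChartAt_self (ξ : CotangentBundle E M) :
    extChartAt (cotangentModel E) ξ ξ =
      (extChartAt 𝓘(ℝ, E) ξ.proj ξ.proj, (show E →L[ℝ] ℝ from ξ.2)) := by
  refine Prod.ext (extChart_fst ξ ξ) ((extChart_snd ξ ξ).trans ?_)
  refine ContinuousLinearMap.ext fun v ↦ ?_
  exact congrArg (fun w : E ↦ (show E →L[ℝ] ℝ from ξ.2) w) (symmL_self (E := E) ξ.proj v)

set_option synthInstance.maxHeartbeats 200000 in
theorem exteriorDerivative_liouvilleOf (ξ : CotangentBundle E M) (V W : ξ.Tangent) :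
    exteriorDerivative (cotangentModel E) (liouvilleOf J) ξ V W =
      (show E →L[ℝ] ℝ from V.2) (J ξ.proj W.1)
        + (show E →L[ℝ] ℝ from ξ.2) (fderiv ℝ (J.localExpr ξ.proj)
          (extChartAt 𝓘(ℝ, E) ξ.proj ξ.proj) V.1 W.1)
      - ((show E →L[ℝ] ℝ from W.2) (J ξ.proj V.1)
        + (show E →L[ℝ] ℝ from ξ.2) (fderiv ℝ (J.localExpr ξ.proj)
          (extChartAt 𝓘(ℝ, E) ξ.proj ξ.proj) W.1 V.1)) := by
  have hT : (fun y ↦ (liouvilleOf J ((extChartAt (cotangentModel E) ξ).symm y)).comp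
    (mfderivWithin 𝓘(ℝ, E × (E →L[ℝ] ℝ)) (cotangentModel E)
      (extChartAt (cotangentModel E) ξ).symm (Set.range (cotangentModel E)) y))
      =ᶠ[𝓝 (extChartAt (cotangentModel E) ξ ξ)]
      fun y ↦ (y.2.comp (J.localExpr ξ.proj y.1)).comp
        (ContinuousLinearMap.fst ℝ E (E →L[ℝ] ℝ)) := by
    filter_upwards [extChartAt_target_mem_nhds (I := cotangentModel E) ξ] with y hy
    exact liouvilleOf_chart J ξ hy
  simp only [exteriorDerivative, LinearMap.mk₂_apply, mfderiv_extChartAt_self]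
  rw [ModelWithCorners.range_eq_univ, fderivWithin_univ]
  rw [ModelWithCorners.range_eq_univ] at hT
  rw [hT.fderiv_eq, extChartAt_self]
  -- At the centre of the chart the matrix of `J` is `J` itself; only there may it be replaced,
  -- after differentiation.
  have key : ∀ A B : E × (E →L[ℝ] ℝ),
      (show E →L[ℝ] ℝ from ξ.2) (fderiv ℝ (J.localExpr ξ.proj)
          (extChartAt 𝓘(ℝ, E) ξ.proj ξ.proj) A.1 B.1) +
      A.2 (J.localExpr ξ.proj (extChartAt 𝓘(ℝ, E) ξ.proj ξ.proj) B.1) =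
      A.2 (J ξ.proj B.1) + (show E →L[ℝ] ℝ from ξ.2) (fderiv ℝ (J.localExpr ξ.proj)
          (extChartAt 𝓘(ℝ, E) ξ.proj ξ.proj) A.1 B.1) := fun A B ↦ by
    rw [add_comm]
    exact congrArg (fun w : E ↦ A.2 w + _) (J.localExpr_self ξ.proj B.1)
  have hd := (J.differentiableAt_localExpr ξ.proj).hasFDerivAt
  exact congrArg₂ (· - ·)
    ((fderiv_snd_comp_comp_fst hd _ V W).trans (key V W))
    ((fderiv_snd_comp_comp_fst hd _ W V).trans (key W V))

theorem symplecticForm_mk (ξ : CotangentBundle E M) (a : E) (p : E →L[ℝ] ℝ) (W : ξ.Tangent) :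
    symplecticForm ξ ((a, p) : E × (E →L[ℝ] ℝ)) W = p W.1 - (show E →L[ℝ] ℝ from W.2) a :=
  symplecticForm_apply ξ ((a, p) : E × (E →L[ℝ] ℝ)) W

theorem symplecticForm_left_ext {ξ : CotangentBundle E M} {U V : ξ.Tangent}
    (h : ∀ W, symplecticForm ξ U W = symplecticForm ξ V W) : U = V := by
  refine sub_eq_zero.1 ((symplecticForm_nondegenerate ξ).1 _ fun W ↦ ?_)
  rw [map_sub, LinearMap.sub_apply, h, sub_self]

end CotangentBundle

/-! ### The complete lift in coordinates -/

namespace AlmostComplexStructure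

open CotangentBundle

variable {E : Type*} [NormedAddCommGroup E] [NormedSpace ℝ E] [FiniteDimensional ℝ E]
  {M : Type*} [TopologicalSpace M] [ChartedSpace E M] [IsManifold 𝓘(ℝ, E) ∞ M]
  (J : AlmostComplexStructure E M)

/-- Since `ω_st((a, p), (b, q)) = p(b) - q(a)`, the two components are read off from the
coefficients of `W` in `d(θ(J))(V, W)`; nondegeneracy makes them unique. The flipped derivative is
the term `(D_W J) V`. -/
theorem completeLift_eq (ξ : CotangentBundle E M) (V : ξ.Tangent) :
    J.completeLift ξ V = (((show E →L[ℝ] E from J ξ.proj) V.1,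
      (show E →L[ℝ] ℝ from V.2).comp (show E →L[ℝ] E from J ξ.proj)
      + (show E →L[ℝ] ℝ from ξ.2).comp (fderiv ℝ (J.localExpr ξ.proj)
          (extChartAt 𝓘(ℝ, E) ξ.proj ξ.proj) V.1
        - (fderiv ℝ (J.localExpr ξ.proj)
          (extChartAt 𝓘(ℝ, E) ξ.proj ξ.proj)).flip V.1)) : E × (E →L[ℝ] ℝ)) := by
  refine symplecticForm_left_ext fun W ↦ ?_
  rw [symplecticForm_completeLift, exteriorDerivative_liouvilleOf]
  have key (v w : E × (E →L[ℝ] ℝ)) (q : E →L[ℝ] ℝ) (j : E →L[ℝ] E) (D : E →L[ℝ] E →L[ℝ] E) :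
      v.2 (j w.1) + q (D v.1 w.1) - (w.2 (j v.1) + q (D w.1 v.1)) =
        (v.2.comp j + q.comp (D v.1 - D.flip v.1)) w.1 - w.2 (j v.1) := by
    simp
    ring
  exact (key V W _ _ _).trans (symplecticForm_mk ξ _ _ W).symm

end AlmostComplexStructure

/-! ### Lie brackets of fields given by their coordinates -/

namespace VectorField

variable {E : Type*} [NormedAddCommGroup E] [NormedSpace ℝ E]
  {M : Type*} [TopologicalSpace M] [ChartedSpace E M] [IsManifold 𝓘(ℝ, E) ∞ M]

theorem mpullbackWithin_extChartAt_symm_eventuallyEq {x : M} {V : ∀ x : M, TangentSpace 𝓘(ℝ, E) x}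
    {v : E → E}
    (hV : ∀ᶠ x' in 𝓝 x, V x' = (trivializationAt E (TangentSpace 𝓘(ℝ, E)) x).symmL ℝ x'
      (v (extChartAt 𝓘(ℝ, E) x x'))) :
    mpullbackWithin 𝓘(ℝ, E) 𝓘(ℝ, E) (extChartAt 𝓘(ℝ, E) x).symm V (Set.range 𝓘(ℝ, E))
      =ᶠ[𝓝 (extChartAt 𝓘(ℝ, E) x x)] v := by
  have hc : Filter.Tendsto (extChartAt 𝓘(ℝ, E) x).symm (𝓝 (extChartAt 𝓘(ℝ, E) x x)) (𝓝 x) := by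
    have := (continuousAt_extChartAt_symm (I := 𝓘(ℝ, E)) x).tendsto
    rwa [extChartAt_to_inv] at this
  filter_upwards [hc.eventually hV, extChartAt_target_mem_nhds (I := 𝓘(ℝ, E)) x] with y hy hyt
  have hx' : (extChartAt 𝓘(ℝ, E) x).symm y ∈ (chartAt E x).source := by
    have := (extChartAt 𝓘(ℝ, E) x).map_target hyt
    rwa [extChartAt_source] at this
  have hr := (extChartAt 𝓘(ℝ, E) x).right_inv hyt
  have hs := TangentBundle.symmL_trivializationAt (I := 𝓘(ℝ, E)) hx'
  rw [hr] at hs hy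
  rw [mpullbackWithin_apply, hy, ← hs]
  set e := (trivializationAt E (TangentSpace 𝓘(ℝ, E)) x)
  -- Written as a continuous linear equivalence, the derivative of the inverse chart has an honest
  -- inverse, which cancels the frame in the pullback.
  have he : e.symmL ℝ ((extChartAt 𝓘(ℝ, E) x).symm y) =
    ((e.continuousLinearEquivAt ℝ _ hx').symm :
      E →L[ℝ] TangentSpace 𝓘(ℝ, E) ((extChartAt 𝓘(ℝ, E) x).symm y)) := by
    ext w
    exact e.symmL_apply hx' w
  rw [he]
  erw [ContinuousLinearMap.inverse_equiv]
  exact (e.continuousLinearEquivAt ℝ _ hx').apply_symm_apply (v y)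

/-- The manifold bracket is the bracket of the chart pullbacks, transported by the inverse of the
chart's derivative, which is the identity at the centre. Only the germs of the pullbacks matter, and
they are `v` and `w`. -/
theorem mlieBracket_eq_fderiv_sub_fderiv {x : M} {V W : ∀ x : M, TangentSpace 𝓘(ℝ, E) x}
    {v w : E → E}
    (hV : ∀ᶠ x' in 𝓝 x, V x' = (trivializationAt E (TangentSpace 𝓘(ℝ, E)) x).symmL ℝ x'
      (v (extChartAt 𝓘(ℝ, E) x x')))
    (hW : ∀ᶠ x' in 𝓝 x, W x' = (trivializationAt E (TangentSpace 𝓘(ℝ, E)) x).symmL ℝ x'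
      (w (extChartAt 𝓘(ℝ, E) x x'))) :
    mlieBracket 𝓘(ℝ, E) V W x =
      fderiv ℝ w (extChartAt 𝓘(ℝ, E) x x) (v (extChartAt 𝓘(ℝ, E) x x))
        - fderiv ℝ v (extChartAt 𝓘(ℝ, E) x x) (w (extChartAt 𝓘(ℝ, E) x x)) := by
  have h1 := mpullbackWithin_extChartAt_symm_eventuallyEq hV
  have h2 := mpullbackWithin_extChartAt_symm_eventuallyEq hW
  refine Eq.trans ?_ (h1.lieBracket_vectorField_eq h2)
  have h3 : mfderiv 𝓘(ℝ, E) 𝓘(ℝ, E) (extChartAt 𝓘(ℝ, E) x) x = ContinuousLinearMap.id ℝ E :=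
    mfderiv_extChartAt_self
  refine (congrArg (fun A : E →L[ℝ] E ↦ A.inverse (lieBracketWithin ℝ
      (mpullbackWithin 𝓘(ℝ, E) 𝓘(ℝ, E) (extChartAt 𝓘(ℝ, E) x).symm V (Set.range 𝓘(ℝ, E)))
      (mpullbackWithin 𝓘(ℝ, E) 𝓘(ℝ, E) (extChartAt 𝓘(ℝ, E) x).symm W (Set.range 𝓘(ℝ, E)))
      ((extChartAt 𝓘(ℝ, E) x).symm ⁻¹' Set.univ ∩ Set.range 𝓘(ℝ, E))
      (extChartAt 𝓘(ℝ, E) x x))) h3).trans ?_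
  simp only [ContinuousLinearMap.inverse_id, ContinuousLinearMap.id_apply]
  rw [Set.preimage_univ, Set.univ_inter, ModelWithCorners.range_eq_univ]
  exact congrFun lieBracketWithin_univ _

theorem mlieBracket_extend_extend (x : M) (X Z : TangentSpace 𝓘(ℝ, E) x) :
    mlieBracket 𝓘(ℝ, E) (FiberBundle.extend E X) (FiberBundle.extend E Z) x = 0 := by
  have h (Y : TangentSpace 𝓘(ℝ, E) x) : ∀ᶠ x' in 𝓝 x, FiberBundle.extend E Y x' =
      (trivializationAt E (TangentSpace 𝓘(ℝ, E)) x).symmL ℝ x' Y := by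
    filter_upwards [(chartAt E x).open_source.mem_nhds (mem_chart_source E x)] with x' hx'
    exact Connection.extend_eq x Y hx'
  -- Both coordinate functions are constant, so the bracket vanishes.
  have key (a b y : E) : fderiv ℝ (fun _ : E ↦ b) y a - fderiv ℝ (fun _ : E ↦ a) y b = 0 := by simp
  exact (mlieBracket_eq_fderiv_sub_fderiv (E := E) (v := fun _ ↦ X) (w := fun _ ↦ Z)
    (h X) (h Z)).trans (key X Z _)

end VectorField

/-! ### The chart derivative of `J` as a bracket -/

namespace AlmostComplexStructure

variable {E : Type*} [NormedAddCommGroup E] [NormedSpace ℝ E]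
  {M : Type*} [TopologicalSpace M] [ChartedSpace E M] [IsManifold 𝓘(ℝ, E) ∞ M]
  (J : AlmostComplexStructure E M)

/-- The differential of the expression of `J` in the preferred chart at `x`:
`(X, Z) ↦ (D_X J) Z`. -/
noncomputable def chartDeriv : BilinearTensor E M := fun x ↦
  (fderiv ℝ (J.localExpr x) (extChartAt 𝓘(ℝ, E) x x) : E →L[ℝ] E →L[ℝ] E)

theorem mlieBracket_extend_onField_extend (x : M) (X Z : TangentSpace 𝓘(ℝ, E) x) :
    VectorField.mlieBracket 𝓘(ℝ, E) (FiberBundle.extend E X) (J.onField (FiberBundle.extend E Z)) x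
      = J.chartDeriv x X Z := by
  have h : ∀ᶠ x' in 𝓝 x, FiberBundle.extend E X x' =
      (trivializationAt E (TangentSpace 𝓘(ℝ, E)) x).symmL ℝ x' X := by
    filter_upwards [(chartAt E x).open_source.mem_nhds (mem_chart_source E x)] with x' hx'
    exact Connection.extend_eq x X hx'
  have h' : ∀ᶠ x' in 𝓝 x, J.onField (FiberBundle.extend E Z) x' =
      (trivializationAt E (TangentSpace 𝓘(ℝ, E)) x).symmL ℝ x'
        (J.localExpr x (extChartAt 𝓘(ℝ, E) x x') (show E from Z)) := by
    filter_upwards [(chartAt E x).open_source.mem_nhds (mem_chart_source E x)] with x' hx'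
    exact (congrArg (J x') (Connection.extend_eq x Z hx')).trans
      (J.symmL_localExpr x hx' (show E from Z)).symm
  -- The first field has constant coordinates and the second has coordinates `J(y) b`, so only `(D_a
  -- J) b` survives.
  have key (a b : E) : fderiv ℝ (fun y ↦ J.localExpr x y b) (extChartAt 𝓘(ℝ, E) x x) a
      - fderiv ℝ (fun _ : E ↦ a) (extChartAt 𝓘(ℝ, E) x x)
        (J.localExpr x (extChartAt 𝓘(ℝ, E) x x) b) =
      fderiv ℝ (J.localExpr x) (extChartAt 𝓘(ℝ, E) x x) a b := by
    rw [fderiv_clm_apply (J.differentiableAt_localExpr x) (differentiableAt_const _)]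
    simp
  exact (VectorField.mlieBracket_eq_fderiv_sub_fderiv (E := E) (v := fun _ ↦ X)
    (w := fun y ↦ J.localExpr x y (show E from Z)) h h').trans (key X Z)

end AlmostComplexStructure

/-! ### Torsion and `∇J` on fields with constant coordinates -/

namespace Connection

variable {E : Type*} [NormedAddCommGroup E] [NormedSpace ℝ E] [FiniteDimensional ℝ E]
  {M : Type*} [TopologicalSpace M] [ChartedSpace E M] [IsManifold 𝓘(ℝ, E) ∞ M]
  (cov : Connection E M) (J : AlmostComplexStructure E M)

theorem torsionTensor_apply {x : M} {X Y : ∀ x : M, TangentSpace 𝓘(ℝ, E) x}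
    (hX : MDiffAt (T% X) x) (hY : MDiffAt (T% Y) x) :
    torsionTensor cov x (X x) (Y x) =
      cov.toFun Y x (X x) - cov.toFun X x (Y x) - VectorField.mlieBracket 𝓘(ℝ, E) X Y x :=
  have : CompleteSpace E := FiniteDimensional.complete ℝ E
  CovariantDerivative.torsion_apply cov hX hY

theorem torsionTensor_swap (x : M) (X Y : TangentSpace 𝓘(ℝ, E) x) :
    torsionTensor cov x X Y = -torsionTensor cov x Y X :=
  have : CompleteSpace E := FiniteDimensional.complete ℝ E
  CovariantDerivative.torsion_antisymm cov X Y

theorem torsionTensor_eq_extend (x : M) (X Y : TangentSpace 𝓘(ℝ, E) x) :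
    torsionTensor cov x X Y = cov.toFun (FiberBundle.extend E Y) x X
      - cov.toFun (FiberBundle.extend E X) x Y := by
  have h := torsionTensor_apply cov (x := x) (FiberBundle.mdifferentiableAt_extend 𝓘(ℝ, E) E X)
    (FiberBundle.mdifferentiableAt_extend 𝓘(ℝ, E) E Y)
  rw [VectorField.mlieBracket_extend_extend, sub_zero] at h
  simpa using h

/-- Both fields differentiated have the value `JZ` at `x`, and the torsion is tensorial. Evaluating
`T(X, JZ)` once with each field, the terms `∇_{JZ} X̂` agree, so the covariant derivatives differ by
the bracket `[X̂, JẐ] = (D_X J) Z`. No expansion in a frame is needed. -/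
theorem cov_onField_extend (x : M) (X Z : TangentSpace 𝓘(ℝ, E) x) :
    cov.toFun (J.onField (FiberBundle.extend E Z)) x X =
      cov.toFun (FiberBundle.extend E (J x Z)) x X
        + J.chartDeriv x X Z := by
  have h := torsionTensor_apply cov (x := x) (FiberBundle.mdifferentiableAt_extend 𝓘(ℝ, E) E X)
    (J.mdifferentiableAt_onField (FiberBundle.mdifferentiableAt_extend 𝓘(ℝ, E) E Z))
  rw [J.mlieBracket_extend_onField_extend] at h
  simp only [AlmostComplexStructure.onField, FiberBundle.extend_apply_self] at h
  rw [torsionTensor_eq_extend] at h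
  rw [← sub_add_cancel (cov.toFun (J.onField (FiberBundle.extend E Z)) x X)
    (cov.toFun (FiberBundle.extend E X) x (J x Z) + J.chartDeriv x X Z), ← sub_sub, ← h]
  abel

theorem nabla_apply {x : M} {X Y : ∀ x : M, TangentSpace 𝓘(ℝ, E) x}
    (hX : MDiffAt (T% X) x) (hY : MDiffAt (T% Y) x) :
    nabla cov J x (X x) (Y x) = cov.toFun (J.onField Y) x (X x) - J x (cov.toFun Y x (X x)) :=
  TensorialAt.mkHom₂_apply _ _ hX hY

theorem nabla_eq_extend (x : M) (X Z : TangentSpace 𝓘(ℝ, E) x) :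
    nabla cov J x X Z = cov.toFun (J.onField (FiberBundle.extend E Z)) x X
      - J x (cov.toFun (FiberBundle.extend E Z) x X) := by
  have h := nabla_apply cov J (x := x) (FiberBundle.mdifferentiableAt_extend 𝓘(ℝ, E) E X)
    (FiberBundle.mdifferentiableAt_extend 𝓘(ℝ, E) E Z)
  simpa using h

end Connection

/-! ### Injectivity of `γ` -/

namespace CotangentBundle

variable {E : Type*} [NormedAddCommGroup E] [NormedSpace ℝ E]
  {M : Type*} [TopologicalSpace M] [ChartedSpace E M] [IsManifold 𝓘(ℝ, E) ∞ M]

theorem gamma_eq (R : BilinearTensor E M) (ξ : CotangentBundle E M) (V : ξ.Tangent) :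
    gamma R ξ V = ((0, (ξ.2 : TangentSpace 𝓘(ℝ, E) ξ.proj →L[ℝ] ℝ).comp (R ξ.proj V.1)) :
      E × (E →L[ℝ] ℝ)) := by
  refine (fibreVelocity_eq ξ _).trans (Prod.ext rfl ?_)
  exact congrArg (fun X : TangentSpace 𝓘(ℝ, E) ξ.proj ↦
    (ξ.2 : TangentSpace 𝓘(ℝ, E) ξ.proj →L[ℝ] ℝ).comp (R ξ.proj X)) (dproj_apply ξ V)

theorem gamma_injective : Function.Injective (gamma (E := E) (M := M)) := by
  intro R R' h
  funext x
  refine ContinuousLinearMap.ext fun X ↦ ContinuousLinearMap.ext fun Z ↦ ?_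
  by_contra hne
  -- The point of the fibre over `x` is free, so a covector separating the two values serves as `ξ`;
  -- then `γ` is evaluated on `(X, 0)`.
  obtain ⟨η, hη⟩ := SeparatingDual.exists_separating_of_ne (R := ℝ) (V := E) hne
  let ξ : CotangentBundle E M := ⟨x, η⟩
  let V : ξ.Tangent := ((X, (0 : E →L[ℝ] ℝ)) : E × (E →L[ℝ] ℝ))
  have h1 : gamma R ξ V = gamma R' ξ V := by rw [h]
  have h2 := ((gamma_eq R ξ V).symm.trans h1).trans (gamma_eq R' ξ V)
  exact hη (congrArg (fun A : E × (E →L[ℝ] ℝ) ↦ A.2 Z) h2)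

end CotangentBundle

/-! ### The tensor `S` and the generalized horizontal lift -/

namespace Connection

open CotangentBundle

section

variable {E : Type*} [NormedAddCommGroup E] [NormedSpace ℝ E] [FiniteDimensional ℝ E]
  {M : Type*} [TopologicalSpace M] [ChartedSpace E M] [IsManifold 𝓘(ℝ, E) ∞ M]
  (cov : Connection E M) (J : AlmostComplexStructure E M)

theorem tensorS_apply (x : M) (X Y : TangentSpace 𝓘(ℝ, E) x) :
    tensorS cov J x X Y = -(nabla cov J x X Y) + nabla cov J x Y X
      + torsionTensor cov x (J x X) Y - J x (torsionTensor cov x X Y) := rfl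

theorem bracketNabla_apply (x : M) (X Y : TangentSpace 𝓘(ℝ, E) x) :
    bracketNabla cov J x X Y = -(nabla cov J x X Y) + nabla cov J x Y X := rfl

/-- The torsion terms in `S` are what removes `J∇_X Ẑ`, `J∇_Z X̂` and `∇_Z (JX)^`. What remains is
the vertical difference between `J^G` and `J^c`. -/
theorem tensorS_eq_extend (x : M) (X Z : TangentSpace 𝓘(ℝ, E) x) :
    tensorS cov J x X Z = cov.toFun (FiberBundle.extend E Z) x (J x X)
      - cov.toFun (FiberBundle.extend E (J x Z)) x X - J.chartDeriv x X Z + J.chartDeriv x Z X := by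
  simp only [tensorS_apply, nabla_eq_extend, cov_onField_extend, torsionTensor_eq_extend, map_sub]
  abel

theorem symmetrization_apply (Y : ∀ x : M, TangentSpace 𝓘(ℝ, E) x) (x : M)
    (X : TangentSpace 𝓘(ℝ, E) x) :
    (symmetrization cov).toFun Y x X = cov.toFun Y x X - (1 / 2 : ℝ) • torsionTensor cov x X (Y x) :=
  (sub_eq_add_neg _ _).symm

theorem nabla_symmetrization (x : M) (X Y : TangentSpace 𝓘(ℝ, E) x) :
    nabla (symmetrization cov) J x X Y = nabla cov J x X Y
      - (1 / 2 : ℝ) • torsionTensor cov x X (J x Y)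
      + (1 / 2 : ℝ) • J x (torsionTensor cov x X Y) := by
  simp only [nabla_eq_extend, symmetrization_apply, AlmostComplexStructure.onField,
    FiberBundle.extend_apply_self, map_sub, map_smul]
  module

/-- Antisymmetrizing the correction `-½ T(X, JY) + ½ J T(X, Y)` of `∇J` yields `½ T(X, JY) + ½ T(JX,
Y) - J T(X, Y)`: the `J T` terms cancel against those of `S`, and half of `T(JX, Y)` is left over.
-/
theorem tensorS_sub_bracketNabla_symmetrization (x : M) (X Y : TangentSpace 𝓘(ℝ, E) x) :
    tensorS cov J x X Y - bracketNabla (symmetrization cov) J x X Y =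
      (1 / 2 : ℝ) • (torsionTensor cov x (J x X) Y - torsionTensor cov x X (J x Y)) := by
  rw [tensorS_apply, bracketNabla_apply, nabla_symmetrization, nabla_symmetrization,
    torsionTensor_swap cov x Y (J x X), torsionTensor_swap cov x Y X, map_neg]
  module

end

variable {E : Type*} [NormedAddCommGroup E] [NormedSpace ℝ E] [FiniteDimensional ℝ E]
  {M : Type*} [TopologicalSpace M] [T2Space M] [ChartedSpace E M] [IsManifold 𝓘(ℝ, E) ∞ M]
  (cov : Connection E M) (J : AlmostComplexStructure E M)

theorem horizontalLift_eq (ξ : CotangentBundle E M) (X : TangentSpace 𝓘(ℝ, E) ξ.proj)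
    {p : CotangentSpace E ξ.proj} (hp : ∀ Z : TangentSpace 𝓘(ℝ, E) ξ.proj,
      p Z = ξ.2 (cov.toFun (FiberBundle.extend E Z) ξ.proj X)) :
    horizontalLift cov ξ X = ((X, p) : E × (E →L[ℝ] ℝ)) := by
  have h : (LinearEquiv.ofBijective _ (bijective_dproj_horizontal cov ξ)).symm X =
      ⟨((X, p) : E × (E →L[ℝ] ℝ)), (mem_horizontalSet cov ξ X p).2 hp⟩ := by
    rw [LinearEquiv.symm_apply_eq]
    exact (dproj_apply ξ ((X, p) : E × (E →L[ℝ] ℝ))).symm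
  exact congrArg Subtype.val h

theorem verticalProjection_eq (ξ : CotangentBundle E M) (V : ξ.Tangent)
    {p : CotangentSpace E ξ.proj} (hp : ∀ Z : TangentSpace 𝓘(ℝ, E) ξ.proj,
      p Z = ξ.2 (cov.toFun (FiberBundle.extend E Z) ξ.proj V.1)) :
    verticalProjection cov ξ V = (show CotangentSpace E ξ.proj from V.2) - p := by
  -- The splitting is explicit: `(X, q) = (0, q - p) + (X, p)`, with `p` the covector that makes
  -- `(X, p)` horizontal.
  have hV : V = verticalLift ξ ((show CotangentSpace E ξ.proj from V.2) - p) +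
      horizontalLift cov ξ V.1 := by
    rw [horizontalLift_eq cov ξ V.1 hp]
    refine Eq.trans ?_ (congrArg (· + (((V.1, p) : E × (E →L[ℝ] ℝ)) : ξ.Tangent))
      (fibreVelocity_eq ξ ((show CotangentSpace E ξ.proj from V.2) - p)).symm)
    exact Prod.ext (zero_add (V.1 : E)).symm (sub_add_cancel (V.2 : E →L[ℝ] ℝ) p).symm
  have hH : horizontalLift cov ξ V.1 ∈ horizontalSpace cov ξ := Subtype.prop _
  conv_lhs => rw [hV]
  rw [verticalProjection, map_add, LinearMap.linearProjOfIsCompl_apply_left,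
    LinearMap.linearProjOfIsCompl_apply_right' _ _ _ _ _ hH, add_zero]

/-- Both sides have base component `JX`; the fibre components agree by the chart formula for `S`. -/
theorem _root_.AlmostComplexStructure.generalizedHorizontalLift_eq :
    J.generalizedHorizontalLift cov = J.completeLift + gamma (tensorS cov J) := by
  funext ξ
  refine LinearMap.ext fun V ↦ ?_
  obtain ⟨p, hp⟩ := exists_horizontal cov ξ V.1
  obtain ⟨p', hp'⟩ := exists_horizontal cov ξ (J ξ.proj V.1)
  change horizontalLift cov ξ (J ξ.proj (dproj ξ V)) +
    fibreVelocity ξ ((verticalProjection cov ξ V).comp (J ξ.proj)) =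
    J.completeLift ξ V + gamma (tensorS cov J) ξ V
  rw [dproj_apply, horizontalLift_eq cov ξ _ hp', verticalProjection_eq cov ξ V hp,
    J.completeLift_eq, gamma_eq, fibreVelocity_eq]
  refine Prod.ext rfl (ContinuousLinearMap.ext fun Z : E ↦ ?_)
  have h (X Z : TangentSpace 𝓘(ℝ, E) ξ.proj) {p p' : CotangentSpace E ξ.proj}
      (hp : ∀ Z : TangentSpace 𝓘(ℝ, E) ξ.proj,
        p Z = ξ.2 (cov.toFun (FiberBundle.extend E Z) ξ.proj X))
      (hp' : ∀ Z : TangentSpace 𝓘(ℝ, E) ξ.proj,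
        p' Z = ξ.2 (cov.toFun (FiberBundle.extend E Z) ξ.proj (J ξ.proj X))) :
      ξ.2 (tensorS cov J ξ.proj X Z) = p' Z - p (J ξ.proj Z) - ξ.2 (J.chartDeriv ξ.proj X Z)
        + ξ.2 (J.chartDeriv ξ.proj Z X) := by
    rw [tensorS_eq_extend, map_add, map_sub, map_sub, hp', hp]
  -- Here `a = ξ(S(X, Z))`, `b = p_{JX}(Z)`, `c = p_X(JZ)`, `f = q(JZ)`, while `d` and `e` are `ξ`
  -- of `(D_X J) Z` and `(D_Z J) X`.
  have key (a b c d e f : ℝ) (h : a = b - c - d + e) : b + (f - c) = f + (d - e) + a := by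
    rw [h]; ring
  refine (key _ _ _ _ _ ((show E →L[ℝ] ℝ from V.2) (J ξ.proj Z))
    (h V.1 Z hp hp')).trans ?_
  refine congrArg (fun t : ℝ ↦ (show E →L[ℝ] ℝ from V.2) (J ξ.proj Z) + t
    + ξ.2 (tensorS cov J ξ.proj V.1 Z)) ?_
  exact ((show E →L[ℝ] ℝ from ξ.2).map_sub _ _).symm

end Connection

/-! ### Satô's lift and the symmetries of the Nijenhuis tensor -/

namespace AlmostComplexStructure

open CotangentBundle Connection

variable {E : Type*} [NormedAddCommGroup E] [NormedSpace ℝ E] [FiniteDimensional ℝ E]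
  {M : Type*} [TopologicalSpace M] [ChartedSpace E M] [IsManifold 𝓘(ℝ, E) ∞ M]
  (J : AlmostComplexStructure E M)

theorem satoLift_eq :
    J.satoLift = J.completeLift + gamma (fun x ↦ -((1 / 2 : ℝ) • J.compNijenhuis x)) := by
  funext ξ
  refine LinearMap.ext fun V ↦ ?_
  change J.completeLift ξ V - (1 / 2 : ℝ) • gamma J.compNijenhuis ξ V =
    J.completeLift ξ V + gamma (fun x ↦ -((1 / 2 : ℝ) • J.compNijenhuis x)) ξ V
  rw [sub_eq_add_neg, gamma_eq, gamma_eq]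
  refine congrArg (J.completeLift ξ V + ·) (Prod.ext ?_ (ContinuousLinearMap.ext fun Z : E ↦ ?_))
  · change -((1 / 2 : ℝ) • (0 : E)) = 0
    simp
  · change -((1 / 2 : ℝ) • ξ.2 (J.compNijenhuis ξ.proj V.1 Z)) =
      ξ.2 (-((1 / 2 : ℝ) • J.compNijenhuis ξ.proj V.1 Z))
    rw [map_neg, map_smul]

theorem nijenhuis_apply {x : M} {X Y : ∀ x : M, TangentSpace 𝓘(ℝ, E) x}
    (hX : MDiffAt (T% X) x) (hY : MDiffAt (T% Y) x) :
    J.nijenhuis x (X x) (Y x) = J.nijenhuisField X Y x :=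
  TensorialAt.mkHom₂_apply _ _ hX hY

theorem nijenhuis_swap (x : M) (X Y : TangentSpace 𝓘(ℝ, E) x) :
    J.nijenhuis x X Y = -J.nijenhuis x Y X :=
  J.nijenhuisField_swap _ _ x

/-- Replacing `X` by `JX` and using `J² = -Id` permutes the four brackets of `N_J` up to the factor
`-J`. -/
theorem nijenhuisField_onField_left {x : M} {X Y : ∀ x : M, TangentSpace 𝓘(ℝ, E) x}
    (hX : MDiffAt (T% X) x) :
    J.nijenhuisField (J.onField X) Y x = -J x (J.nijenhuisField X Y x) := by
  have : CompleteSpace E := FiniteDimensional.complete ℝ E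
  simp only [nijenhuisField, onField_onField]
  rw [VectorField.mlieBracket_const_smul_left hX, VectorField.mlieBracket_const_smul_left hX]
  simp only [map_sub, map_smul, J.sq']
  module

theorem nijenhuis_apply_left (x : M) (X Y : TangentSpace 𝓘(ℝ, E) x) :
    J.nijenhuis x (J x X) Y = -J x (J.nijenhuis x X Y) := by
  have hX := FiberBundle.mdifferentiableAt_extend 𝓘(ℝ, E) E X
  have hY := FiberBundle.mdifferentiableAt_extend 𝓘(ℝ, E) E Y
  have h := J.nijenhuis_apply (J.mdifferentiableAt_onField hX) hY
  rw [J.nijenhuisField_onField_left hX, ← J.nijenhuis_apply hX hY] at h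
  simpa [onField] using h

theorem nijenhuis_apply_right (x : M) (X Y : TangentSpace 𝓘(ℝ, E) x) :
    J.nijenhuis x X (J x Y) = -J x (J.nijenhuis x X Y) := by
  rw [J.nijenhuis_swap x X (J x Y), J.nijenhuis_apply_left, J.nijenhuis_swap x X Y, map_neg]

theorem compNijenhuis_apply (x : M) (X Y : TangentSpace 𝓘(ℝ, E) x) :
    J.compNijenhuis x X Y = J x (J.nijenhuis x X Y) := rfl

end AlmostComplexStructure

theorem Connection.IsMinimal.torsionTensor_apply_left {E : Type*} [NormedAddCommGroup E]
    [NormedSpace ℝ E] [FiniteDimensional ℝ E] {M : Type*} [TopologicalSpace M] [ChartedSpace E M]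
    [IsManifold 𝓘(ℝ, E) ∞ M] {cov : Connection E M} {J : AlmostComplexStructure E M}
    (h : IsMinimal cov J) (x : M) (X Y : TangentSpace 𝓘(ℝ, E) x) :
    torsionTensor cov x (J x X) Y = torsionTensor cov x X (J x Y) := by
  rw [h x]
  simp only [smul_apply, J.nijenhuis_apply_left, J.nijenhuis_apply_right]

/-! ### Almost complex minimal connections -/

namespace Connection

variable {E : Type*} [NormedAddCommGroup E] [NormedSpace ℝ E] [FiniteDimensional ℝ E]
  {M : Type*} [TopologicalSpace M] [T2Space M] [ChartedSpace E M] [IsManifold 𝓘(ℝ, E) ∞ M]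
  {cov : Connection E M} {J : AlmostComplexStructure E M}

theorem IsAlmostComplex.nabla_eq_zero (h : IsAlmostComplex cov J) (x : M)
    (X Y : TangentSpace 𝓘(ℝ, E) x) : nabla cov J x X Y = 0 := by
  -- The hypothesis concerns globally smooth fields only, so the vectors are extended with a cutoff;
  -- tensoriality recovers the values at `x`.
  obtain ⟨X', hX', hXe⟩ := exists_global (E := E) (F := E)
    (V := (TangentSpace 𝓘(ℝ, E) : M → Type _)) x X
  obtain ⟨Y', hY', hYe⟩ := exists_global (E := E) (F := E)
    (V := (TangentSpace 𝓘(ℝ, E) : M → Type _)) x Y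
  have h1 := nabla_apply cov J (hX'.contMDiffAt.mdifferentiableAt (x := x) (by simp))
    (hY'.contMDiffAt.mdifferentiableAt (x := x) (by simp))
  rw [h X' Y' hX' hY' x, sub_self, hXe.self_of_nhds, hYe.self_of_nhds] at h1
  simpa using h1

theorem tensorS_eq_of_isAlmostComplex_of_isMinimal (h : IsAlmostComplex cov J)
    (h' : IsMinimal cov J) (x : M) : tensorS cov J x = -((1 / 2 : ℝ) • J.compNijenhuis x) := by
  refine ContinuousLinearMap.ext fun X ↦ ContinuousLinearMap.ext fun Y ↦ ?_
  change tensorS cov J x X Y = -((1 / 2 : ℝ) • J.compNijenhuis x X Y)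
  rw [tensorS_apply, h.nabla_eq_zero, h.nabla_eq_zero, h' x, J.compNijenhuis_apply]
  -- `T(JX, Y)` and `-J T(X, Y)` each contribute `-¼ J N_J(X, Y)`.
  simp only [smul_apply, J.nijenhuis_apply_left, map_smul]
  module

end Connection

/-! ### The comparison of the lifts -/

namespace AlmostComplexStructure

open CotangentBundle Connection

variable {E : Type*} [NormedAddCommGroup E] [NormedSpace ℝ E] [FiniteDimensional ℝ E]
  {M : Type*} [TopologicalSpace M] [T2Space M] [ChartedSpace E M] [IsManifold 𝓘(ℝ, E) ∞ M]
  (J : AlmostComplexStructure E M) (cov : Connection E M)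

theorem generalizedHorizontalLift_eq_satoLift_iff :
    J.generalizedHorizontalLift cov = J.satoLift ↔
      ∀ x : M, tensorS cov J x = -((1 / 2 : ℝ) • J.compNijenhuis x) := by
  rw [generalizedHorizontalLift_eq, J.satoLift_eq]
  exact ⟨fun h x ↦ congrFun (gamma_injective (add_left_cancel h)) x,
    fun h ↦ congrArg (J.completeLift + gamma ·) (funext h)⟩

theorem generalizedHorizontalLift_eq_horizontalLift_iff :
    J.generalizedHorizontalLift cov = J.horizontalLift cov ↔
      ∀ (x : M) (X Y : TangentSpace 𝓘(ℝ, E) x),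
        torsionTensor cov x (J x X) Y = torsionTensor cov x X (J x Y) := by
  rw [generalizedHorizontalLift_eq, horizontalLift]
  have key (x : M) (X Y : TangentSpace 𝓘(ℝ, E) x) :
      tensorS cov J x X Y = bracketNabla (symmetrization cov) J x X Y ↔
        torsionTensor cov x (J x X) Y = torsionTensor cov x X (J x Y) := by
    rw [← sub_eq_zero, tensorS_sub_bracketNabla_symmetrization, smul_eq_zero, sub_eq_zero]
    norm_num
  constructor
  · intro h x X Y
    rw [← key, gamma_injective (add_left_cancel h)]
  · intro h
    refine congrArg (J.completeLift + gamma ·) (funext fun x ↦ ?_)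
    exact ContinuousLinearMap.ext fun X ↦ ContinuousLinearMap.ext fun Y ↦ (key x X Y).2 (h x X Y)

end AlmostComplexStructure

theorem theorem1 {E : Type*} [NormedAddCommGroup E] [NormedSpace ℝ E] [FiniteDimensional ℝ E]
    {M : Type*} [TopologicalSpace M] [T2Space M] [ChartedSpace E M] [IsManifold 𝓘(ℝ, E) ∞ M]
    (J : AlmostComplexStructure E M) :
    (∀ cov : Connection E M, CovariantDerivative.ContMDiffCovariantDerivative cov ∞ →
      (J.generalizedHorizontalLift cov = J.satoLift ↔
        ∀ x : M, Connection.tensorS cov J x = -((1 / 2 : ℝ) • J.compNijenhuis x))) ∧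
    (∀ cov : Connection E M, CovariantDerivative.ContMDiffCovariantDerivative cov ∞ →
      (J.generalizedHorizontalLift cov = J.horizontalLift cov ↔
        ∀ (x : M) (X Y : TangentSpace 𝓘(ℝ, E) x),
          Connection.torsionTensor cov x (J x X) Y = Connection.torsionTensor cov x X (J x Y))) ∧
    (∀ cov : Connection E M, CovariantDerivative.ContMDiffCovariantDerivative cov ∞ →
      Connection.IsAlmostComplex cov J → Connection.IsMinimal cov J →
        J.generalizedHorizontalLift cov = J.satoLift ∧ J.satoLift = J.horizontalLift cov) := by
  refine ⟨fun cov _ ↦ J.generalizedHorizontalLift_eq_satoLift_iff cov,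
    fun cov _ ↦ J.generalizedHorizontalLift_eq_horizontalLift_iff cov, fun cov _ h h' ↦ ?_⟩
  have h1 := (J.generalizedHorizontalLift_eq_satoLift_iff cov).2
    (Connection.tensorS_eq_of_isAlmostComplex_of_isMinimal h h')
  exact ⟨h1, h1.symm.trans
    ((J.generalizedHorizontalLift_eq_horizontalLift_iff cov).2 h'.torsionTensor_apply_left)⟩
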